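/- Let $(M_1,g_1)$ and $(M_2,g_2)$ be nonempty Riemannian manifolds ($C^\infty$, Hausdorff, without boundary, finite-dimensional) of positive dimension, and suppose that the geodesic flow of at least one of them is Anosov. Then the geodesic flow of the product $(M_1\times M_2,\,g_1+g_2)$ is not partially hyperbolic. Here, for a Riemannian manifold $(M,g)$ whose geodesics are defined for all times, $\phi_t$ is the geodesic flow $\phi_t(x,v)=(\gamma_{(x,v)}(t),\gamma_{(x,v)}'(t))$ on the unit tangent bundle $UM$, $X$ is the geodesic vector field, and the quotient bundle $T(UM)/\langle X\rangle$ carries the quotient norm of the Sasaki metric. The geodesic flow is called *partially hyperbolic* if it is defined for all times and there are a splitting $T(UM)/\langle X\rangle=E^s\oplus E^c\oplus E^u$ into nonzero continuous subbundles, invariant under $d\phi_t$ for all $t\in\mathbb R$, and constants $\lambda<\mu<0<C$ such that for all $\theta\in UM$ and $t\ge 0$: $$\|d_\theta\phi_t\,\xi\|\le Ce^{\lambda t}\|\xi\|\ (\xi\in E^s(\theta)),\qquad \|d_\theta\phi_{-t}\,\xi\|\le Ce^{\lambda t}\|\xi\|\ (\xi\in E^u(\theta)),$$ $$C^{-1}e^{\mu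 t}\|\xi\|\le\|d_\theta\phi_t\,\xi\|\le Ce^{-\mu t}\|\xi\|\ (\xi\in E^c(\theta)).$$ It is called *Anosov* if the same holds with $E^c=0$ (and $E^s,E^u$ nonzero). -/

import Mathlib

open Bundle Manifold Set
open scoped ContDiff Topology

noncomputable section

namespace GeodesicFlow

set_option linter.unusedSectionVars false

/-! ### Riemannian metrics -/

/-- A smooth (`C^∞`) Riemannian metric on the manifold `M`. -/
abbrev Metric {E : Type*} [NormedAddCommGroup E] [NormedSpace ℝ E] {H : Type*}
    [TopologicalSpace H] (I : ModelWithCorners ℝ E H) (M : Type*) [TopologicalSpace M]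
    [ChartedSpace H M] [IsManifold I ∞ M] : Type _ :=
  ContMDiffRiemannianMetric I ∞ E (fun x : M => TangentSpace I x)

lemma inner_self_nonneg {E : Type*} [NormedAddCommGroup E] [NormedSpace ℝ E] {H : Type*}
    [TopologicalSpace H] {I : ModelWithCorners ℝ E H} {M : Type*} [TopologicalSpace M]
    [ChartedSpace H M] [IsManifold I ∞ M] (g : Metric I M) (x : M) (v : TangentSpace I x) :
    0 ≤ g.inner x v v := by
  by_cases h : v = 0
  · simp [h]
  · exact (g.pos x v h).le

section ProductMetric

/-- A map into `E →L E →L ℝ`, with `E` finite-dimensional, is smooth at a point as soon as all its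
matrix coefficients are. -/
lemma contMDiffAt_bilin {E : Type*} [NormedAddCommGroup E] [NormedSpace ℝ E]
    [FiniteDimensional ℝ E] {E' : Type*} [NormedAddCommGroup E'] [NormedSpace ℝ E'] {H : Type*}
    [TopologicalSpace H] {I : ModelWithCorners ℝ E' H} {M : Type*} [TopologicalSpace M]
    [ChartedSpace H M] {f : M → E →L[ℝ] E →L[ℝ] ℝ} {x : M}
    (h : ∀ v w : E, ContMDiffAt I 𝓘(ℝ, ℝ) ∞ (fun y => f y v w) x) :
    ContMDiffAt I 𝓘(ℝ, E →L[ℝ] E →L[ℝ] ℝ) ∞ f x := by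
  let b := Module.finBasis ℝ E
  let d : Fin (Module.finrank ℝ E) → E →L[ℝ] ℝ := fun i => LinearMap.toContinuousLinearMap (b.coord i)
  have key : f = fun y => ∑ i, ∑ j, f y (b i) (b j) • ((d i).smulRight (d j)) := by
    funext y
    ext v w
    have hv := b.sum_repr v
    have hw := b.sum_repr w
    conv_lhs => rw [← hv, ← hw]
    simp only [map_sum, map_smul, _root_.sum_apply, _root_.smul_apply,
      ContinuousLinearMap.smulRight_apply, smul_eq_mul]
    rw [Finset.sum_comm]
    simp only [d, LinearMap.coe_toContinuousLinearMap', Module.Basis.coord_apply, Finset.mul_sum]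
    refine Finset.sum_congr rfl fun i _ => Finset.sum_congr rfl fun j _ => by ring
  rw [key]
  refine ContMDiffAt.sum fun i _ => ContMDiffAt.sum fun j _ => ?_
  exact (h (b i) (b j)).smul contMDiffAt_const

variable {E₁ : Type*} [NormedAddCommGroup E₁] [NormedSpace ℝ E₁] [FiniteDimensional ℝ E₁]
  {H₁ : Type*} [TopologicalSpace H₁] {I₁ : ModelWithCorners ℝ E₁ H₁}
  {M₁ : Type*} [TopologicalSpace M₁] [ChartedSpace H₁ M₁] [IsManifold I₁ ∞ M₁]
  {E₂ : Type*} [NormedAddCommGroup E₂] [NormedSpace ℝ E₂] [FiniteDimensional ℝ E₂]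
  {H₂ : Type*} [TopologicalSpace H₂] {I₂ : ModelWithCorners ℝ E₂ H₂}
  {M₂ : Type*} [TopologicalSpace M₂] [ChartedSpace H₂ M₂] [IsManifold I₂ ∞ M₂]

/-- The inner product `g₁ + g₂` on `T_{(x, y)} (M₁ × M₂) = T_x M₁ × T_y M₂`. -/
def prodInner (g₁ : Metric I₁ M₁) (g₂ : Metric I₂ M₂) (p : M₁ × M₂) :
    TangentSpace (I₁.prod I₂) p →L[ℝ] TangentSpace (I₁.prod I₂) p →L[ℝ] ℝ :=
  letI b₁ : E₁ →L[ℝ] E₁ →L[ℝ] ℝ := g₁.inner p.1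
  letI b₂ : E₂ →L[ℝ] E₂ →L[ℝ] ℝ := g₂.inner p.2
  (b₁.bilinearComp (ContinuousLinearMap.fst ℝ E₁ E₂) (ContinuousLinearMap.fst ℝ E₁ E₂) +
    b₂.bilinearComp (ContinuousLinearMap.snd ℝ E₁ E₂) (ContinuousLinearMap.snd ℝ E₁ E₂) :
    E₁ × E₂ →L[ℝ] E₁ × E₂ →L[ℝ] ℝ)

lemma prodInner_apply (g₁ : Metric I₁ M₁) (g₂ : Metric I₂ M₂) (p : M₁ × M₂)
    (v w : TangentSpace (I₁.prod I₂) p) :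
    prodInner g₁ g₂ p v w = g₁.inner p.1 v.1 w.1 + g₂.inner p.2 v.2 w.2 := rfl

lemma contMDiffAt_inner_fst (g₁ : Metric I₁ M₁) {p₀ : M₁ × M₂}
    {V W : ∀ p : M₁ × M₂, TangentSpace (I₁.prod I₂) p}
    (hV : ContMDiffAt (I₁.prod I₂) (I₁.prod I₂).tangent ∞
      (fun p => (⟨p, V p⟩ : TangentBundle (I₁.prod I₂) (M₁ × M₂))) p₀)
    (hW : ContMDiffAt (I₁.prod I₂) (I₁.prod I₂).tangent ∞
      (fun p => (⟨p, W p⟩ : TangentBundle (I₁.prod I₂) (M₁ × M₂))) p₀) :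
    ContMDiffAt (I₁.prod I₂) 𝓘(ℝ, ℝ) ∞ (fun p => g₁.inner p.1 (V p).1 (W p).1) p₀ := by
  have T : ContMDiff (I₁.prod I₂).tangent I₁.tangent ∞
      (tangentMap (I₁.prod I₂) I₁ (Prod.fst : M₁ × M₂ → M₁)) :=
    contMDiff_fst.contMDiff_tangentMap (n := ∞) le_rfl
  rw [show tangentMap (I₁.prod I₂) I₁ (Prod.fst : M₁ × M₂ → M₁) =
    fun q => ⟨q.proj.1, q.2.1⟩ from funext fun q => tangentMap_prodFst] at T
  have h : ContMDiffAt (I₁.prod I₂) (I₁.prod 𝓘(ℝ)) ∞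
      (fun p : M₁ × M₂ => TotalSpace.mk' ℝ (E := Bundle.Trivial M₁ ℝ) p.1
        (g₁.inner p.1 (V p).1 (W p).1)) p₀ := by
    apply ContMDiffAt.clm_bundle_apply₂ (F₁ := E₁) (F₂ := E₁)
    · exact g₁.contMDiff.contMDiffAt.comp p₀ contMDiffAt_fst
    · exact T.contMDiffAt.comp p₀ hV
    · exact T.contMDiffAt.comp p₀ hW
  simp only [contMDiffAt_totalSpace] at h
  exact h.2

lemma contMDiffAt_inner_snd (g₂ : Metric I₂ M₂) {p₀ : M₁ × M₂}
    {V W : ∀ p : M₁ × M₂, TangentSpace (I₁.prod I₂) p}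
    (hV : ContMDiffAt (I₁.prod I₂) (I₁.prod I₂).tangent ∞
      (fun p => (⟨p, V p⟩ : TangentBundle (I₁.prod I₂) (M₁ × M₂))) p₀)
    (hW : ContMDiffAt (I₁.prod I₂) (I₁.prod I₂).tangent ∞
      (fun p => (⟨p, W p⟩ : TangentBundle (I₁.prod I₂) (M₁ × M₂))) p₀) :
    ContMDiffAt (I₁.prod I₂) 𝓘(ℝ, ℝ) ∞ (fun p => g₂.inner p.2 (V p).2 (W p).2) p₀ := by
  have T : ContMDiff (I₁.prod I₂).tangent I₂.tangent ∞
      (tangentMap (I₁.prod I₂) I₂ (Prod.snd : M₁ × M₂ → M₂)) :=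
    contMDiff_snd.contMDiff_tangentMap (n := ∞) le_rfl
  rw [show tangentMap (I₁.prod I₂) I₂ (Prod.snd : M₁ × M₂ → M₂) =
    fun q => ⟨q.proj.2, q.2.2⟩ from funext fun q => tangentMap_prodSnd] at T
  have h : ContMDiffAt (I₁.prod I₂) (I₂.prod 𝓘(ℝ)) ∞
      (fun p : M₁ × M₂ => TotalSpace.mk' ℝ (E := Bundle.Trivial M₂ ℝ) p.2
        (g₂.inner p.2 (V p).2 (W p).2)) p₀ := by
    apply ContMDiffAt.clm_bundle_apply₂ (F₁ := E₂) (F₂ := E₂)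
    · exact g₂.contMDiff.contMDiffAt.comp p₀ contMDiffAt_snd
    · exact T.contMDiffAt.comp p₀ hV
    · exact T.contMDiffAt.comp p₀ hW
  simp only [contMDiffAt_totalSpace] at h
  exact h.2

lemma contMDiff_prodInner (g₁ : Metric I₁ M₁) (g₂ : Metric I₂ M₂) :
    ContMDiff (I₁.prod I₂) ((I₁.prod I₂).prod 𝓘(ℝ, E₁ × E₂ →L[ℝ] E₁ × E₂ →L[ℝ] ℝ)) ∞
      (fun p : M₁ × M₂ => TotalSpace.mk' (E₁ × E₂ →L[ℝ] E₁ × E₂ →L[ℝ] ℝ)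
        (E := fun p : M₁ × M₂ => TangentSpace (I₁.prod I₂) p →L[ℝ]
          TangentSpace (I₁.prod I₂) p →L[ℝ] ℝ) p (prodInner g₁ g₂ p)) := by
  intro p₀
  rw [contMDiffAt_section]
  refine contMDiffAt_bilin fun v w => ?_
  let e := trivializationAt (E₁ × E₂) (TangentSpace (I₁.prod I₂) : M₁ × M₂ → Type _) p₀
  have hp₀ : p₀ ∈ e.baseSet := mem_baseSet_trivializationAt _ _ p₀
  have hs : ∀ u : E₁ × E₂, ContMDiffAt (I₁.prod I₂) (I₁.prod I₂).tangent ∞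
      (fun p => (⟨p, e.symmL ℝ p u⟩ : TangentBundle (I₁.prod I₂) (M₁ × M₂))) p₀ := fun u =>
    by
      have h₁ : ContMDiffAt (I₁.prod I₂) ((I₁.prod I₂).prod 𝓘(ℝ, E₁ × E₂)) ∞
          (fun p : M₁ × M₂ => (p, u)) p₀ := contMDiffAt_id.prodMk contMDiffAt_const
      have h₂ := (e.contMDiffOn_symm (IB := I₁.prod I₂) (n := ∞)).contMDiffAt
        (e.open_target.mem_nhds (e.mem_target.2 hp₀ : (p₀, u) ∈ e.target))
      refine (h₂.comp p₀ h₁).congr_of_eventuallyEq ?_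
      filter_upwards [e.open_baseSet.mem_nhds hp₀] with p hp
      rw [e.symmL_apply hp]
      exact e.mk_symm hp u
  have h := (contMDiffAt_inner_fst g₁ (hs v) (hs w)).add (contMDiffAt_inner_snd g₂ (hs v) (hs w))
  refine h.congr_of_eventuallyEq ?_
  filter_upwards [e.open_baseSet.mem_nhds hp₀] with p hp
  have hp' : p ∈ (trivializationAt (E₁ × E₂) (TangentSpace (I₁.prod I₂) : M₁ × M₂ → Type _)
    p₀).baseSet := hp
  rw [hom_trivializationAt_apply]
  dsimp only
  rw [inCoordinates_apply_eq₂ hp' hp' (mem_univ p)]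
  simp only [Pi.add_apply, e.symmL_apply hp, Trivial.fiberBundle_trivializationAt',
    Trivial.linearMapAt_trivialization]
  rfl

/-- The product metric `g₁ + g₂` on `M₁ × M₂`. -/
def Metric.prod (g₁ : Metric I₁ M₁) (g₂ : Metric I₂ M₂) : Metric (I₁.prod I₂) (M₁ × M₂) where
  inner := prodInner g₁ g₂
  symm p v w := congrArg₂ (· + ·) (g₁.symm p.1 v.1 w.1) (g₂.symm p.2 v.2 w.2)
  pos p v hv := by
    rw [prodInner_apply]
    have h₁ := inner_self_nonneg g₁ p.1 v.1
    have h₂ := inner_self_nonneg g₂ p.2 v.2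
    by_cases h : v.1 = 0
    · have : v.2 ≠ 0 := fun h' => hv (Prod.ext h h')
      linarith [g₂.pos p.2 v.2 this]
    · linarith [g₁.pos p.1 v.1 h]
  isVonNBounded p := by
    have b₁ : Bornology.IsVonNBounded ℝ {v : E₁ | g₁.inner p.1 v v < 1} := g₁.isVonNBounded p.1
    have b₂ : Bornology.IsVonNBounded ℝ {v : E₂ | g₂.inner p.2 v v < 1} := g₂.isVonNBounded p.2
    change Bornology.IsVonNBounded ℝ {v : E₁ × E₂ | prodInner g₁ g₂ p v v < 1}
    rw [NormedSpace.isVonNBounded_iff] at b₁ b₂ ⊢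
    refine (b₁.prod b₂).subset fun v (hv : g₁.inner p.1 v.1 v.1 + g₂.inner p.2 v.2 v.2 < 1) => ?_
    have h₁ := inner_self_nonneg g₁ p.1 v.1
    have h₂ := inner_self_nonneg g₂ p.2 v.2
    exact ⟨show g₁.inner p.1 v.1 v.1 < 1 by linarith, show g₂.inner p.2 v.2 v.2 < 1 by linarith⟩
  contMDiff := contMDiff_prodInner g₁ g₂

end ProductMetric

/-! ### Levi-Civita connection, geodesics and the Sasaki metric

Recall that `TangentSpace I x` is the model space `E`, a vector being identified with its coordinates
in the preferred chart `extChartAt I x` at `x`. Likewise, the tangent space of the tangent bundle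
`TM` at `θ = (x, v)` is `E × E`: the coordinates are those induced on `TM` by the chart at `x`, that
is, `(x¹, …, xⁿ, v¹, …, vⁿ)`. -/

section Sasaki

variable {E : Type*} [NormedAddCommGroup E] [NormedSpace ℝ E] [FiniteDimensional ℝ E]
  {H : Type*} [TopologicalSpace H] {I : ModelWithCorners ℝ E H} [I.Boundaryless]
  {M : Type*} [TopologicalSpace M] [ChartedSpace H M] [IsManifold I ∞ M]

/-- The inner product `g_x` on `T_x M = E`, as a bilinear form. -/
def metricForm (g : Metric I M) (x : M) : LinearMap.BilinForm ℝ E :=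
  letI b : E →L[ℝ] E →L[ℝ] ℝ := g.inner x
  b.toBilinForm

lemma metricForm_apply (g : Metric I M) (x : M) (v w : E) :
    metricForm g x v w = g.inner x (v : TangentSpace I x) (w : TangentSpace I x) := rfl

lemma metricForm_nondegenerate (g : Metric I M) (x : M) : (metricForm g x).Nondegenerate := by
  have h : ∀ v : E, metricForm g x v v = 0 → v = 0 := fun v hv => by
    by_contra hne
    exact (g.pos x v hne).ne' hv
  exact ⟨fun v hv => h v (hv v), fun v hv => h v (hv v)⟩

/-- The matrix `(g_{ij})` of the metric in the preferred chart at `x`, as a function of the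
coordinates `z`: the pull-back of `g` by the inverse of the chart. -/
def coordMetric (g : Metric I M) (x : M) (z : E) : E →L[ℝ] E →L[ℝ] ℝ :=
  letI b : E →L[ℝ] E →L[ℝ] ℝ := g.inner ((extChartAt I x).symm z)
  letI T : E →L[ℝ] E := mfderiv 𝓘(ℝ, E) I (extChartAt I x).symm z
  b.bilinearComp T T

set_option synthInstance.maxHeartbeats 400000 in
/-- The derivative of `coordMetric g x` at the point `x`: `coordMetricDeriv g x c a b` is
`(∂_c g)(a, b)`. -/
def coordMetricDeriv (g : Metric I M) (x : M) : E →L[ℝ] E →L[ℝ] E →L[ℝ] ℝ :=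
  fderiv ℝ (coordMetric g x) (extChartAt I x x)

/-- The Christoffel symbols at `x` of the Levi-Civita connection of `g` in the preferred chart at
`x`: `Γ(a, b)` is the vector with
`g_x(Γ(a, b), c) = ((∂_a g)(b, c) + (∂_b g)(a, c) - (∂_c g)(a, b)) / 2` for all `c`. -/
def christoffel (g : Metric I M) (x : M) (a b : E) : E :=
  ((metricForm g x).toDual (metricForm_nondegenerate g x)).symm
    ((1 / 2 : ℝ) • (coordMetricDeriv g x a b + coordMetricDeriv g x b a -
      ((coordMetricDeriv g x).flip a).flip b : E →L[ℝ] ℝ).toLinearMap)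

lemma inner_christoffel (g : Metric I M) (x : M) (a b c : E) :
    metricForm g x (christoffel g x a b) c =
      (1 / 2 : ℝ) * (coordMetricDeriv g x a b c + coordMetricDeriv g x b a c -
        coordMetricDeriv g x c a b) :=
  LinearMap.BilinForm.apply_toDual_symm_apply (B := metricForm g x)
    (hB := metricForm_nondegenerate g x) _ c

/-- `γ : ℝ → M` is a geodesic of `g`: it is smooth and satisfies `u'' + Γ(u', u') = 0` at every time
`t₀`, where `u` is `γ` read in the preferred chart at `γ t₀`. -/
def IsGeodesic (g : Metric I M) (γ : ℝ → M) : Prop :=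
  ContMDiff 𝓘(ℝ, ℝ) I ∞ γ ∧
    ∀ t₀ : ℝ, letI u : ℝ → E := fun t => extChartAt I (γ t₀) (γ t)
      deriv (deriv u) t₀ + christoffel g (γ t₀) (deriv u t₀) (deriv u t₀) = 0

/-- The velocity `(γ(t), γ'(t))` of a curve, a point of `TM`. -/
def velocity (γ : ℝ → M) (t : ℝ) : TangentBundle I M :=
  ⟨γ t, mfderiv 𝓘(ℝ, ℝ) I γ t (1 : ℝ)⟩

/-- `φ` is the geodesic flow of `g` on `TM`: a smooth map `ℝ × TM → TM` such that
`φ_t(x, v) = (γ(t), γ'(t))`, where `γ` is the geodesic with `γ(0) = x` and `γ'(0) = v`. -/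
def IsGeodesicFlow (g : Metric I M) (φ : ℝ → TangentBundle I M → TangentBundle I M) : Prop :=
  ContMDiff (𝓘(ℝ, ℝ).prod I.tangent) I.tangent ∞
      (fun p : ℝ × TangentBundle I M => φ p.1 p.2) ∧
    ∀ θ : TangentBundle I M, ∃ γ : ℝ → M, IsGeodesic g γ ∧ velocity (I := I) γ 0 = θ ∧
      ∀ t : ℝ, φ t θ = velocity (I := I) γ t

/-- The differential `d_θ π : T_θ TM → T_x M` of the projection `π : TM → M`, at `θ = (x, v)`. -/
def dProj (θ : TangentBundle I M) : TangentSpace I.tangent θ →L[ℝ] TangentSpace I θ.proj :=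
  mfderiv I.tangent I (TotalSpace.proj : TangentBundle I M → M) θ

/-- In the coordinates `E × E` on `T_θ TM`, the differential of the projection is the first
component. -/
lemma dProj_apply (θ : TangentBundle I M) (ξ : E × E) : dProj θ ξ = ξ.1 := by
  have h : MDifferentiableAt I.tangent I (TotalSpace.proj : TangentBundle I M → M) θ :=
    (contMDiffAt_proj (n := 1) (TangentSpace I)).mdifferentiableAt (by simp)
  unfold dProj
  rw [h.mfderiv]
  have : HasFDerivWithinAt (writtenInExtChartAt I.tangent I θ (TotalSpace.proj : TangentBundle I M → M)) (ContinuousLinearMap.fst ℝ E E) (range I.tangent) (extChartAt I.tangent θ θ) := by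
    have : HasFDerivAt (Prod.fst : E × E → E) (ContinuousLinearMap.fst ℝ E E) (extChartAt I.tangent θ θ) := hasFDerivAt_fst
    suffices h : writtenInExtChartAt I.tangent I θ (TotalSpace.proj : TangentBundle I M → M)
        =ᶠ[𝓝[range I.tangent] (extChartAt I.tangent θ θ)] Prod.fst from
      (this.hasFDerivWithinAt (s := range I.tangent)).congr_of_eventuallyEq h
        (h.self_of_nhdsWithin (mem_range_self _))
    filter_upwards [extChartAt_target_mem_nhdsWithin (I := I.tangent) θ] with y hy
    have h1 : (extChartAt I.tangent θ ((extChartAt I.tangent θ).symm y)).1 = y.1 := by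
      rw [(extChartAt I.tangent θ).right_inv hy]
    rw [← h1]
    change extChartAt I θ.proj _ = I (chartAt (ModelProd H E) θ ((extChartAt I.tangent θ).symm y)).1
    rw [TangentBundle.coe_chartAt_fst]
    rfl
  rw [this.fderivWithin (I.tangent.uniqueDiffOn _ (mem_range_self _))]
  rfl

/-- The connection map `K_θ : T_θ TM → T_x M`, at `θ = (x, v)`. If `ξ = z'(0)` with
`z(s) = (α(s), Z(s))`, then in coordinates `ξ = (α'(0), Z'(0))` and
`K_θ(ξ) = (∇_{α'} Z)(0) = Z'(0) + Γ(α'(0), v)`. -/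
def connectionMap (g : Metric I M) (θ : TangentBundle I M) (ξ : TangentSpace I.tangent θ) :
    TangentSpace I θ.proj :=
  letI ξ' : E × E := ξ
  ξ'.2 + christoffel g θ.proj ξ'.1 θ.2

/-- The norm on `T_θ TM` of the Sasaki metric,
`‖ξ‖² = g_x(d_θ π ξ, d_θ π ξ) + g_x(K_θ ξ, K_θ ξ)`. -/
def sasakiNorm (g : Metric I M) (θ : TangentBundle I M) (ξ : TangentSpace I.tangent θ) : ℝ :=
  √(g.inner θ.proj (dProj θ ξ) (dProj θ ξ) +
    g.inner θ.proj (connectionMap g θ ξ) (connectionMap g θ ξ))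

/-- The geodesic vector field on `TM`, with horizontal part `v` and vertical part `0` at
`θ = (x, v)`. -/
def geodesicField (g : Metric I M) (θ : TangentBundle I M) : TangentSpace I.tangent θ :=
  letI v : E := θ.2
  ((v, -christoffel g θ.proj v v) : E × E)

/-- The geodesic vector field is `(v, 0)` in the horizontal-vertical decomposition. -/
lemma geodesicField_components (g : Metric I M) (θ : TangentBundle I M) :
    dProj θ (geodesicField g θ) = θ.2 ∧ connectionMap g θ (geodesicField g θ) = 0 :=
  ⟨dProj_apply θ _, neg_add_cancel (christoffel g θ.proj θ.2 θ.2 : E)⟩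

/-! ### The unit tangent bundle and its quotient by the geodesic vector field -/

/-- The function `(x, v) ↦ g_x(v, v)` on `TM`. -/
def normSq (g : Metric I M) (θ : TangentBundle I M) : ℝ := g.inner θ.proj θ.2 θ.2

/-- The unit tangent bundle `UM`. -/
def unitBundle (g : Metric I M) : Set (TangentBundle I M) := {θ | normSq g θ = 1}

/-- For `θ ∈ UM`, the tangent space `T_θ UM`, as a subspace of `T_θ TM`: the kernel of the
differential of the defining function of the level set `UM`. -/
def unitTangent (g : Metric I M) (θ : TangentBundle I M) :
    Submodule ℝ (TangentSpace I.tangent θ) :=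
  LinearMap.ker (mfderiv I.tangent 𝓘(ℝ, ℝ) (normSq g) θ).toLinearMap

/-- The quotient of `T_θ TM` by the line spanned by the geodesic vector field. -/
abbrev FlowQuot (g : Metric I M) (θ : TangentBundle I M) : Type _ :=
  TangentSpace I.tangent θ ⧸ Submodule.span ℝ {geodesicField g θ}

/-- The class of a tangent vector of `TM` in the quotient by the geodesic vector field. -/
def toQuot (g : Metric I M) (θ : TangentBundle I M) :
    TangentSpace I.tangent θ →ₗ[ℝ] FlowQuot g θ :=
  Submodule.mkQ _

/-- The fiber at `θ ∈ UM` of the quotient bundle `T(UM) / ⟨X⟩`, where `X` is the geodesic vector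
field. -/
def unitQuot (g : Metric I M) (θ : TangentBundle I M) : Submodule ℝ (FlowQuot g θ) :=
  (unitTangent g θ).map (toQuot g θ)

/-- The quotient norm on the quotient by the geodesic vector field, induced by the Sasaki
metric. -/
def quotNorm (g : Metric I M) (θ : TangentBundle I M) (q : FlowQuot g θ) : ℝ :=
  sInf (sasakiNorm g θ '' {ξ | toQuot g θ ξ = q})

/-- A family of subspaces of the fibers of `T(TM) / ⟨X⟩`, of which only the members over `UM`
matter. -/
abbrev Distribution (g : Metric I M) : Type _ :=
  ∀ θ : TangentBundle I M, Submodule ℝ (FlowQuot g θ)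

/-- The family `F` is a continuous vector subbundle over `UM`: near every point of `UM` it has a
frame consisting of the classes of finitely many continuous vector fields. -/
def IsContinuousSubbundle (g : Metric I M) (F : Distribution g) : Prop :=
  ∀ θ₀ ∈ unitBundle g, ∃ U ∈ 𝓝 θ₀, ∃ (k : ℕ)
    (s : Fin k → ∀ θ : TangentBundle I M, TangentSpace I.tangent θ),
    (∀ i, ContinuousOn
      (fun θ => (⟨θ, s i θ⟩ : TangentBundle I.tangent (TangentBundle I M)))
      (U ∩ unitBundle g)) ∧
    ∀ θ ∈ U ∩ unitBundle g,
      LinearIndependent ℝ (fun i => toQuot g θ (s i θ)) ∧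
      Submodule.span ℝ (range fun i => toQuot g θ (s i θ)) = F θ

/-- The differential `d_θ φ_t`. -/
def flowDeriv (φ : ℝ → TangentBundle I M → TangentBundle I M) (t : ℝ) (θ : TangentBundle I M) :
    TangentSpace I.tangent θ →L[ℝ] TangentSpace I.tangent (φ t θ) :=
  mfderiv I.tangent I.tangent (φ t) θ

/-- `d_θ φ_t (F(θ)) = F(φ_t θ)` for all `t` and all `θ ∈ UM`. -/
def IsInvariant (g : Metric I M) (φ : ℝ → TangentBundle I M → TangentBundle I M)
    (F : Distribution g) : Prop :=
  ∀ t : ℝ, ∀ θ ∈ unitBundle g,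
    (((F θ).comap (toQuot g θ)).map (flowDeriv φ t θ).toLinearMap).map (toQuot g (φ t θ)) =
      F (φ t θ)

/-! ### Partial hyperbolicity -/

/-- `Es ⊕ Ec ⊕ Eu` is a continuous invariant splitting of `T(UM) / ⟨X⟩`, with `Es` and `Eu` nonzero,
where `Es` is contracted and `Eu` is expanded exponentially with rate `lam`, and vectors of `Ec`
are neither contracted nor expanded faster than with rate `mu`, where `lam < mu < 0`. -/
structure IsHyperbolicSplitting (g : Metric I M)
    (φ : ℝ → TangentBundle I M → TangentBundle I M) (Es Ec Eu : Distribution g)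
    (C lam mu : ℝ) : Prop where
  lam_lt : lam < mu
  mu_neg : mu < 0
  C_pos : 0 < C
  cont_s : IsContinuousSubbundle g Es
  cont_c : IsContinuousSubbundle g Ec
  cont_u : IsContinuousSubbundle g Eu
  indep : ∀ θ ∈ unitBundle g, iSupIndep ![Es θ, Ec θ, Eu θ]
  sup_eq : ∀ θ ∈ unitBundle g, Es θ ⊔ Ec θ ⊔ Eu θ = unitQuot g θ
  nontrivial_s : ∀ θ ∈ unitBundle g, Es θ ≠ ⊥
  nontrivial_u : ∀ θ ∈ unitBundle g, Eu θ ≠ ⊥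
  inv_s : IsInvariant g φ Es
  inv_c : IsInvariant g φ Ec
  inv_u : IsInvariant g φ Eu
  contract_s : ∀ t : ℝ, 0 ≤ t → ∀ θ ∈ unitBundle g, ∀ ξ : TangentSpace I.tangent θ,
    toQuot g θ ξ ∈ Es θ →
      quotNorm g (φ t θ) (toQuot g (φ t θ) (flowDeriv φ t θ ξ)) ≤
        C * Real.exp (t * lam) * quotNorm g θ (toQuot g θ ξ)
  contract_u : ∀ t : ℝ, 0 ≤ t → ∀ θ ∈ unitBundle g, ∀ ξ : TangentSpace I.tangent θ,
    toQuot g θ ξ ∈ Eu θ →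
      quotNorm g (φ (-t) θ) (toQuot g (φ (-t) θ) (flowDeriv φ (-t) θ ξ)) ≤
        C * Real.exp (t * lam) * quotNorm g θ (toQuot g θ ξ)
  center_lower : ∀ t : ℝ, 0 ≤ t → ∀ θ ∈ unitBundle g, ∀ ξ : TangentSpace I.tangent θ,
    toQuot g θ ξ ∈ Ec θ →
      C⁻¹ * Real.exp (t * mu) * quotNorm g θ (toQuot g θ ξ) ≤
        quotNorm g (φ t θ) (toQuot g (φ t θ) (flowDeriv φ t θ ξ))
  center_upper : ∀ t : ℝ, 0 ≤ t → ∀ θ ∈ unitBundle g, ∀ ξ : TangentSpace I.tangent θ,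
    toQuot g θ ξ ∈ Ec θ →
      quotNorm g (φ t θ) (toQuot g (φ t θ) (flowDeriv φ t θ ξ)) ≤
        C * Real.exp (-(t * mu)) * quotNorm g θ (toQuot g θ ξ)

/-- The geodesic flow of `g` is defined for all times and is partially hyperbolic on `UM`. -/
def HasPartiallyHyperbolicGeodesicFlow (g : Metric I M) : Prop :=
  ∃ φ : ℝ → TangentBundle I M → TangentBundle I M, IsGeodesicFlow g φ ∧
    ∃ (Es Ec Eu : Distribution g) (C lam mu : ℝ),
      IsHyperbolicSplitting g φ Es Ec Eu C lam mu ∧ ∀ θ ∈ unitBundle g, Ec θ ≠ ⊥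

/-- The geodesic flow of `g` is defined for all times and is Anosov on `UM`: it has a hyperbolic
splitting with vanishing center. -/
def HasAnosovGeodesicFlow (g : Metric I M) : Prop :=
  ∃ φ : ℝ → TangentBundle I M → TangentBundle I M, IsGeodesicFlow g φ ∧
    ∃ (Es Ec Eu : Distribution g) (C lam mu : ℝ),
      IsHyperbolicSplitting g φ Es Ec Eu C lam mu ∧ ∀ θ ∈ unitBundle g, Ec θ = ⊥

end Sasaki

end GeodesicFlow

end

noncomputable section

namespace GeodesicFlow

set_option linter.unusedSectionVars false

section Charts

variable {E : Type*} [NormedAddCommGroup E] [NormedSpace ℝ E]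
  {H : Type*} [TopologicalSpace H] {I : ModelWithCorners ℝ E H} [I.Boundaryless]
  {M : Type*} [TopologicalSpace M] [ChartedSpace H M] [IsManifold I ∞ M]

lemma extChartAt_tangent (θ η : TangentBundle I M) :
    extChartAt I.tangent θ η =
      (extChartAt I θ.1 η.1, tangentCoordChange I η.1 θ.1 η.1 η.2) := by
  rw [FiberBundle.extChartAt]
  simp [TangentBundle.trivializationAt_apply]

lemma hasFDerivAt_tangentCoordChange {x y z : M}
    (h : z ∈ (extChartAt I x).source ∩ (extChartAt I y).source) :
    HasFDerivAt (extChartAt I y ∘ (extChartAt I x).symm) (tangentCoordChange I x y z)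
      (extChartAt I x z) := by
  simpa [I.range_eq_univ] using hasFDerivWithinAt_tangentCoordChange (I := I) h

lemma hasMFDerivAt_extChartAt_symm (x : M) {z : E} (hz : z ∈ (extChartAt I x).target) :
    letI L : E →L[ℝ] E :=
      tangentCoordChange I x ((extChartAt I x).symm z) ((extChartAt I x).symm z)
    HasMFDerivAt 𝓘(ℝ, E) I (extChartAt I x).symm z L := by
  refine ⟨(continuousOn_extChartAt_symm x).continuousAt
    ((isOpen_extChartAt_target x).mem_nhds hz), ?_⟩
  have := hasFDerivAt_tangentCoordChange (I := I) (x := x) (y := (extChartAt I x).symm z)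
    ⟨(extChartAt I x).map_target hz, mem_extChartAt_source _⟩
  rw [(extChartAt I x).right_inv hz] at this
  exact this.hasFDerivWithinAt

lemma hasMFDerivAt_extChartAt_tangentCoordChange {x y : M} (hy : y ∈ (extChartAt I x).source) :
    letI L : E →L[ℝ] E := tangentCoordChange I y x y
    HasMFDerivAt I 𝓘(ℝ, E) (extChartAt I x) y L := by
  refine ⟨continuousAt_extChartAt' hy, ?_⟩
  exact (hasFDerivAt_tangentCoordChange (I := I)
    ⟨mem_extChartAt_source y, hy⟩).hasFDerivWithinAt

lemma tangentCoordChange_comp_symm {x y : M} (hy : y ∈ (extChartAt I x).source) (v : E) :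
    tangentCoordChange I x y y (tangentCoordChange I y x y v) = v := by
  rw [tangentCoordChange_comp ⟨⟨mem_extChartAt_source y, hy⟩, mem_extChartAt_source y⟩]
  exact tangentCoordChange_self (mem_extChartAt_source y)

variable [FiniteDimensional ℝ E]

lemma coordMetric_apply (g : Metric I M) (x : M) {z : E} (hz : z ∈ (extChartAt I x).target)
    (a b : E) :
    coordMetric g x z a b = g.inner ((extChartAt I x).symm z)
      (tangentCoordChange I x ((extChartAt I x).symm z) ((extChartAt I x).symm z) a)
      (tangentCoordChange I x ((extChartAt I x).symm z) ((extChartAt I x).symm z) b) := by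
  have h := (hasMFDerivAt_extChartAt_symm (I := I) x hz).mfderiv
  change g.inner ((extChartAt I x).symm z) (mfderiv 𝓘(ℝ, E) I (extChartAt I x).symm z a)
    (mfderiv 𝓘(ℝ, E) I (extChartAt I x).symm z b) = _
  rw [h]
  rfl

lemma inner_eq_coordMetric (g : Metric I M) {x y : M} (hy : y ∈ (extChartAt I x).source)
    (a b : E) :
    metricForm g y a b = coordMetric g x (extChartAt I x y)
      (tangentCoordChange I y x y a) (tangentCoordChange I y x y b) := by
  rw [coordMetric_apply g x ((extChartAt I x).map_source hy), (extChartAt I x).left_inv hy,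
    tangentCoordChange_comp_symm hy, tangentCoordChange_comp_symm hy]
  rfl

lemma coordMetric_self (g : Metric I M) (x : M) (a b : E) :
    coordMetric g x (extChartAt I x x) a b = metricForm g x a b := by
  rw [inner_eq_coordMetric g (mem_extChartAt_source x),
    tangentCoordChange_self (mem_extChartAt_source x),
    tangentCoordChange_self (mem_extChartAt_source x)]

lemma contDiffAt_coordMetric (g : Metric I M) (x : M) {z : E}
    (hz : z ∈ (extChartAt I x).target) : ContDiffAt ℝ ∞ (coordMetric g x) z := by
  rw [← contMDiffAt_iff_contDiffAt]
  refine contMDiffAt_bilin fun v w => ?_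
  have hn := (isOpen_extChartAt_target (I := I) x).mem_nhds hz
  have hsymm : ContMDiffOn 𝓘(ℝ, E) I ∞ (extChartAt I x).symm (extChartAt I x).target :=
    contMDiffOn_extChartAt_symm x
  have hT := hsymm.contMDiffOn_tangentMapWithin (m := ∞) le_rfl
    (isOpen_extChartAt_target (I := I) x).uniqueMDiffOn
  have hs : ∀ u : E, ContMDiffAt 𝓘(ℝ, E) I.tangent ∞ (fun z' : E =>
      (⟨(extChartAt I x).symm z', mfderiv 𝓘(ℝ, E) I (extChartAt I x).symm z' u⟩ :
        TangentBundle I M)) z := fun u => by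
    have hc : ContMDiffAt 𝓘(ℝ, E) 𝓘(ℝ, E).tangent ∞
        (fun z' : E => (⟨z', u⟩ : TangentBundle 𝓘(ℝ, E) E)) z := by
      exact (contMDiffAt_vectorSpace_iff_contDiffAt (V := fun _ => u)).2 contDiffAt_const
    have := (hT.contMDiffAt (((isOpen_extChartAt_target (I := I) x).preimage
      (FiberBundle.continuous_proj E (TangentSpace 𝓘(ℝ, E) : E → Type _))).mem_nhds
      (x := (⟨z, u⟩ : TangentBundle 𝓘(ℝ, E) E)) hz)).comp z hc
    refine this.congr_of_eventuallyEq ?_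
    filter_upwards [hn] with z' hz'
    simp only [Function.comp, tangentMapWithin]
    rw [mfderivWithin_of_mem_nhds ((isOpen_extChartAt_target (I := I) x).mem_nhds hz')]
  have h : ContMDiffAt 𝓘(ℝ, E) (I.prod 𝓘(ℝ)) ∞
      (fun z' : E => TotalSpace.mk' ℝ (E := Bundle.Trivial M ℝ) ((extChartAt I x).symm z')
        (g.inner ((extChartAt I x).symm z')
          (mfderiv 𝓘(ℝ, E) I (extChartAt I x).symm z' v)
          (mfderiv 𝓘(ℝ, E) I (extChartAt I x).symm z' w))) z := by
    apply ContMDiffAt.clm_bundle_apply₂ (F₁ := E) (F₂ := E)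
    · exact g.contMDiff.contMDiffAt.comp z (hsymm.contMDiffAt hn)
    · exact hs v
    · exact hs w
  simp only [contMDiffAt_totalSpace] at h
  exact h.2

instance : NormedAddCommGroup (E →L[ℝ] E →L[ℝ] ℝ) := ContinuousLinearMap.toNormedAddCommGroup

instance : NormedSpace ℝ (E →L[ℝ] E →L[ℝ] ℝ) := ContinuousLinearMap.toNormedSpace

lemma hasFDerivAt_coordMetric (g : Metric I M) (x : M) :
    HasFDerivAt (coordMetric g x) (coordMetricDeriv g x) (extChartAt I x x) :=
  ((contDiffAt_coordMetric g x (mem_extChartAt_target x)).differentiableAt (by simp)).hasFDerivAt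

lemma coordMetric_symm (g : Metric I M) (x : M) (z a b : E) :
    coordMetric g x z a b = coordMetric g x z b a :=
  g.symm ((extChartAt I x).symm z) (mfderiv 𝓘(ℝ, E) I (extChartAt I x).symm z a)
    (mfderiv 𝓘(ℝ, E) I (extChartAt I x).symm z b)

lemma coordMetricDeriv_symm (g : Metric I M) (x : M) (c a b : E) :
    coordMetricDeriv g x c a b = coordMetricDeriv g x c b a := by
  have h (a b : E) : HasFDerivAt (fun z => coordMetric g x z a b)
      (((coordMetricDeriv g x).flip a).flip b) (extChartAt I x x) := by
    have h1 := (hasFDerivAt_coordMetric g x).clm_apply (hasFDerivAt_const a _)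
    have h2 := h1.clm_apply (hasFDerivAt_const b _)
    refine h2.congr_fderiv ?_
    ext v
    simp
  have e : (fun z => coordMetric g x z a b) = fun z => coordMetric g x z b a :=
    funext fun z => coordMetric_symm g x z a b
  have := congrArg (fun L : E →L[ℝ] ℝ => L c) ((h a b).unique (e ▸ h b a))
  simpa using this

lemma metricForm_christoffel_left (g : Metric I M) (x : M) (a v : E) :
    metricForm g x (christoffel g x a v) v = (1 / 2 : ℝ) * coordMetricDeriv g x a v v := by
  rw [inner_christoffel, coordMetricDeriv_symm g x v a v]
  ring

lemma metricForm_christoffel_self (g : Metric I M) (x : M) (a b : E) :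
    metricForm g x (christoffel g x a a) b =
      coordMetricDeriv g x a a b - (1 / 2 : ℝ) * coordMetricDeriv g x b a a := by
  rw [inner_christoffel]
  ring

lemma metricForm_symm (g : Metric I M) (x : M) (a b : E) :
    metricForm g x a b = metricForm g x b a := g.symm _ _ _

lemma metricForm_nonneg (g : Metric I M) (x : M) (a : E) : 0 ≤ metricForm g x a a :=
  inner_self_nonneg g x a

lemma eq_zero_of_metricForm_eq_zero (g : Metric I M) (x : M) {a : E}
    (h : metricForm g x a a = 0) : a = 0 := by
  by_contra hne
  exact (g.pos x a hne).ne' h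

lemma christoffel_zero_right (g : Metric I M) (x : M) (a : E) : christoffel g x a 0 = 0 := by
  simp [christoffel]

lemma christoffel_smul_smul (g : Metric I M) (x : M) (s r : ℝ) (a b : E) :
    christoffel g x (s • a) (r • b) = (s * r) • christoffel g x a b := by
  have h : ∀ c, metricForm g x (christoffel g x (s • a) (r • b) - (s * r) • christoffel g x a b) c
      = 0 := fun c => by
    simp only [map_sub, map_smul, LinearMap.sub_apply, LinearMap.smul_apply, inner_christoffel,
      smul_eq_mul, _root_.smul_apply]
    ring
  exact sub_eq_zero.1 (eq_zero_of_metricForm_eq_zero g x (h _))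

lemma christoffel_add_left (g : Metric I M) (x : M) (a a' b : E) :
    christoffel g x (a + a') b = christoffel g x a b + christoffel g x a' b := by
  have h : ∀ c, metricForm g x (christoffel g x (a + a') b -
      (christoffel g x a b + christoffel g x a' b)) c = 0 := fun c => by
    simp only [map_sub, map_add, LinearMap.sub_apply, LinearMap.add_apply, inner_christoffel,
      _root_.add_apply]
    ring
  exact sub_eq_zero.1 (eq_zero_of_metricForm_eq_zero g x (h _))

end Charts

section ChartDerivatives

lemma hasMFDerivAt_of_chart {E : Type*} [NormedAddCommGroup E] [NormedSpace ℝ E]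
    {H : Type*} [TopologicalSpace H] {I : ModelWithCorners ℝ E H}
    {M : Type*} [TopologicalSpace M] [ChartedSpace H M]
    {E' : Type*} [NormedAddCommGroup E'] [NormedSpace ℝ E']
    {H' : Type*} [TopologicalSpace H'] {J : ModelWithCorners ℝ E' H'}
    {N : Type*} [TopologicalSpace N] [ChartedSpace H' N]
    {f : M → N} {x : M} (F : E → E') {L : E →L[ℝ] E'} (hf : ContinuousAt f x)
    (hF : HasFDerivAt F L (extChartAt I x x))
    (h : ∀ᶠ y in 𝓝 x, extChartAt J (f x) (f y) = F (extChartAt I x y)) :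
    letI L' : TangentSpace I x →L[ℝ] TangentSpace J (f x) := L
    HasMFDerivAt I J f x L' := by
  refine ⟨hf, (hF.hasFDerivWithinAt (s := range I)).congr_of_eventuallyEq ?_ ?_⟩
  · have hc : Filter.Tendsto (extChartAt I x).symm (𝓝[range I] (extChartAt I x x)) (𝓝 x) := by
      have := (continuousAt_extChartAt_symm (I := I) x).tendsto
      rw [extChartAt_to_inv] at this
      exact this.mono_left nhdsWithin_le_nhds
    filter_upwards [hc.eventually h, extChartAt_target_mem_nhdsWithin (I := I) x] with z hz hz'
    simp only [writtenInExtChartAt, Function.comp]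
    rw [hz, (extChartAt I x).right_inv hz']
  · simp only [writtenInExtChartAt, Function.comp, extChartAt_to_inv]
    exact h.self_of_nhds

end ChartDerivatives

section Geodesics

variable {E : Type*} [NormedAddCommGroup E] [NormedSpace ℝ E]
  {H : Type*} [TopologicalSpace H] {I : ModelWithCorners ℝ E H} [I.Boundaryless]
  {M : Type*} [TopologicalSpace M] [ChartedSpace H M] [IsManifold I ∞ M]

/-- The fiber component of a tangent vector, as an element of the model space. -/
def vec (θ : TangentBundle I M) : E := θ.2

lemma extChartAt_tangent_eq (θ η : TangentBundle I M) :
    extChartAt I.tangent θ η =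
      (extChartAt I θ.1 η.1, tangentCoordChange I η.1 θ.1 η.1 (vec η)) :=
  extChartAt_tangent θ η

lemma extChartAt_tangent_self (θ : TangentBundle I M) :
    extChartAt I.tangent θ θ = (extChartAt I θ.1 θ.1, vec θ) := by
  rw [extChartAt_tangent_eq, tangentCoordChange_self (mem_extChartAt_source _)]

lemma mem_extChartAt_tangent_source (θ η : TangentBundle I M) :
    η ∈ (extChartAt I.tangent θ).source ↔ η.1 ∈ (extChartAt I θ.1).source := by
  rw [extChartAt_source, extChartAt_source, TangentBundle.mem_chart_source_iff]

lemma eventually_mem_source (θ : TangentBundle I M) :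
    ∀ᶠ η in 𝓝 θ, η.1 ∈ (extChartAt I θ.1).source := by
  filter_upwards [extChartAt_source_mem_nhds (I := I.tangent) θ] with η hη
  exact (mem_extChartAt_tangent_source θ η).1 hη

lemma exists_curve (x : M) (v : E) : ∃ c : ℝ → M, ContMDiffAt 𝓘(ℝ, ℝ) I ∞ c 0 ∧ c 0 = x ∧
    letI w : TangentSpace I x := v
    HasMFDerivAt 𝓘(ℝ, ℝ) I c 0 ((1 : ℝ →L[ℝ] ℝ).smulRight w) := by
  let l : ℝ → E := fun s => extChartAt I x x + s • v
  have hl0 : l 0 = extChartAt I x x := by simp [l]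
  have hl : ContDiff ℝ ∞ l := by fun_prop
  have hmem : (extChartAt I x).target ∈ 𝓝 (l 0) := hl0 ▸ extChartAt_target_mem_nhds (I := I) x
  have hc : ContMDiffAt 𝓘(ℝ, ℝ) I ∞ ((extChartAt I x).symm ∘ l) 0 :=
    ((contMDiffOn_extChartAt_symm (n := ∞) (I := I) x).contMDiffAt hmem).comp 0
      hl.contMDiff.contMDiffAt
  have h0 : ((extChartAt I x).symm ∘ l) 0 = x := by simp [hl0]
  refine ⟨(extChartAt I x).symm ∘ l, hc, h0, hc.continuousAt, ?_⟩
  have hl' : HasFDerivAt l ((1 : ℝ →L[ℝ] ℝ).smulRight v) 0 := by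
    have : HasDerivAt l v 0 := by
      simpa [l] using (((hasDerivAt_id (0 : ℝ)).smul_const v).const_add (extChartAt I x x) :)
    exact this.hasFDerivAt
  refine (hl'.congr_of_eventuallyEq ?_).hasFDerivWithinAt
  filter_upwards [hl.continuous.continuousAt.preimage_mem_nhds hmem] with s hs
  change extChartAt I (((extChartAt I x).symm ∘ l) 0) ((extChartAt I x).symm (l s)) = l s
  rw [h0, (extChartAt I x).right_inv hs]

lemma hasDerivAt_extChartAt_comp {γ : ℝ → M} {t : ℝ} {v : E} (x : M)
    (hγ : letI w : TangentSpace I (γ t) := v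
      HasMFDerivAt 𝓘(ℝ, ℝ) I γ t ((1 : ℝ →L[ℝ] ℝ).smulRight w))
    (ht : γ t ∈ (extChartAt I x).source) :
    HasDerivAt (fun s => extChartAt I x (γ s)) (tangentCoordChange I (γ t) x (γ t) v) t := by
  have h := (hasMFDerivAt_extChartAt_tangentCoordChange ht).comp t hγ
  rw [hasDerivAt_iff_hasFDerivAt]
  refine (hasMFDerivAt_iff_hasFDerivAt.1 h).congr_fderiv (ContinuousLinearMap.ext_ring ?_)
  change tangentCoordChange I (γ t) x (γ t) ((1 : ℝ) • v) = (1 : ℝ) • _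
  rw [one_smul, one_smul]

lemma hasMFDerivAt_velocity {γ : ℝ → M} {t : ℝ} (hγ : MDifferentiableAt 𝓘(ℝ, ℝ) I γ t) :
    HasMFDerivAt 𝓘(ℝ, ℝ) I γ t ((1 : ℝ →L[ℝ] ℝ).smulRight (velocity (I := I) γ t).2) := by
  have h : mfderiv 𝓘(ℝ, ℝ) I γ t =
      (1 : ℝ →L[ℝ] ℝ).smulRight (velocity (I := I) γ t).2 := by
    refine ContinuousLinearMap.ext_ring ?_
    change mfderiv 𝓘(ℝ, ℝ) I γ t (1 : ℝ) = (1 : ℝ) • mfderiv 𝓘(ℝ, ℝ) I γ t (1 : ℝ)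
    rw [one_smul]
  exact h ▸ hγ.hasMFDerivAt

variable [FiniteDimensional ℝ E]

lemma exists_hasFDerivAt_coordMetric (g : Metric I M) (x : M) {F : Type*} [NormedAddCommGroup F]
    [NormedSpace ℝ F] {u p q : F → E} {s : F} {u' p' q' : F →L[ℝ] E} (hu : HasFDerivAt u u' s)
    (hp : HasFDerivAt p p' s) (hq : HasFDerivAt q q' s) (hs : u s = extChartAt I x x) :
    ∃ L : F →L[ℝ] ℝ, HasFDerivAt (fun r => coordMetric g x (u r) (p r) (q r)) L s ∧
      ∀ v, L v = coordMetricDeriv g x (u' v) (p s) (q s) + metricForm g x (p' v) (q s) +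
        metricForm g x (p s) (q' v) := by
  have h0 : HasFDerivAt (fun r => coordMetric g x (u r)) ((coordMetricDeriv g x).comp u') s :=
    HasFDerivAt.comp (g := coordMetric g x) s (hs ▸ hasFDerivAt_coordMetric g x) hu
  refine ⟨_, (h0.clm_apply hp).clm_apply hq, fun v => ?_⟩
  simp only [hs, _root_.add_apply, ContinuousLinearMap.comp_apply, ContinuousLinearMap.flip_apply,
    coordMetric_self]
  ring

lemma hasDerivAt_coordMetric (g : Metric I M) (x : M) {u p q : ℝ → E} {s : ℝ} {u' p' q' : E}
    (hu : HasDerivAt u u' s) (hp : HasDerivAt p p' s) (hq : HasDerivAt q q' s)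
    (hs : u s = extChartAt I x x) :
    HasDerivAt (fun r => coordMetric g x (u r) (p r) (q r))
      (coordMetricDeriv g x u' (p s) (q s) + metricForm g x p' (q s) +
        metricForm g x (p s) q') s := by
  obtain ⟨L, hL, hL'⟩ := exists_hasFDerivAt_coordMetric g x hu.hasFDerivAt hp.hasFDerivAt
    hq.hasFDerivAt hs
  have := hL.hasDerivAt
  rwa [hL', ContinuousLinearMap.toSpanSingleton_apply, ContinuousLinearMap.toSpanSingleton_apply,
    ContinuousLinearMap.toSpanSingleton_apply, one_smul, one_smul, one_smul] at this

lemma exists_hasMFDerivAt_normSq (g : Metric I M) (θ : TangentBundle I M) :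
    ∃ L : E × E →L[ℝ] ℝ,
      (letI L' : TangentSpace I.tangent θ →L[ℝ] ℝ := L
      HasMFDerivAt I.tangent 𝓘(ℝ, ℝ) (normSq g) θ L') ∧
      ∀ ξ : E × E, L ξ = 2 * metricForm g θ.1 (ξ.2 + christoffel g θ.1 ξ.1 (vec θ)) (vec θ) := by
  have hs := extChartAt_tangent_self θ
  obtain ⟨L, hL, hL'⟩ := exists_hasFDerivAt_coordMetric g θ.1 (u := Prod.fst) (p := Prod.snd)
    (q := Prod.snd) (s := extChartAt I.tangent θ θ) hasFDerivAt_fst hasFDerivAt_snd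
    hasFDerivAt_snd (by rw [hs])
  have key : ∀ᶠ η in 𝓝 θ, extChartAt 𝓘(ℝ, ℝ) (normSq g θ) (normSq g η) =
      coordMetric g θ.1 (extChartAt I.tangent θ η).1 (extChartAt I.tangent θ η).2
        (extChartAt I.tangent θ η).2 := by
    filter_upwards [eventually_mem_source θ] with η hη
    rw [extChartAt_tangent_eq]
    exact inner_eq_coordMetric g hη (vec η) (vec η)
  refine ⟨L, hasMFDerivAt_of_chart _ ?_ hL key, fun ξ => ?_⟩
  · have h1 := hL.continuousAt.comp (continuousAt_extChartAt (I := I.tangent) θ)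
    exact h1.congr (key.mono fun η hη => hη.symm)
  · rw [hL', hs]
    simp only [ContinuousLinearMap.coe_fst', ContinuousLinearMap.coe_snd', map_add,
      LinearMap.add_apply]
    rw [metricForm_christoffel_left, metricForm_symm g θ.1 (vec θ) ξ.2]
    ring

lemma mfderiv_normSq_apply (g : Metric I M) (θ : TangentBundle I M) (ξ : E × E) :
    mfderiv I.tangent 𝓘(ℝ, ℝ) (normSq g) θ ξ =
      2 * metricForm g θ.1 (ξ.2 + christoffel g θ.1 ξ.1 (vec θ)) (vec θ) := by
  obtain ⟨L, hL, hL'⟩ := exists_hasMFDerivAt_normSq g θ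
  rw [hL.mfderiv]
  exact hL' ξ

lemma mdifferentiableAt_normSq (g : Metric I M) (θ : TangentBundle I M) :
    MDifferentiableAt I.tangent 𝓘(ℝ, ℝ) (normSq g) θ := by
  obtain ⟨L, hL, -⟩ := exists_hasMFDerivAt_normSq g θ
  exact hL.mdifferentiableAt

lemma IsGeodesic.isMIntegralCurve {g : Metric I M} {γ : ℝ → M} (hγ : IsGeodesic g γ) :
    IsMIntegralCurve (I := I.tangent) (velocity (I := I) γ) (geodesicField g) := by
  intro t₀
  obtain ⟨hs, hγ⟩ := hγ
  have hd : ∀ t, MDifferentiableAt 𝓘(ℝ, ℝ) I γ t := fun t => (hs t).mdifferentiableAt (by simp)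
  specialize hγ t₀
  set u : ℝ → E := fun t => extChartAt I (γ t₀) (γ t) with hu
  have hmem : ∀ᶠ t in 𝓝 t₀, γ t ∈ (extChartAt I (γ t₀)).source :=
    hs.continuous.continuousAt.preimage_mem_nhds (extChartAt_source_mem_nhds _)
  have huS : ContDiffAt ℝ ∞ u t₀ := by
    rw [← contMDiffAt_iff_contDiffAt]
    exact (contMDiffAt_extChartAt (n := ∞)).comp t₀ (hs t₀)
  have hderiv : ∀ᶠ t in 𝓝 t₀, HasDerivAt u
      (tangentCoordChange I (γ t) (γ t₀) (γ t) (vec (velocity (I := I) γ t))) t := by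
    filter_upwards [hmem] with t ht
    exact hasDerivAt_extChartAt_comp (γ t₀) (hasMFDerivAt_velocity (hd t)) ht
  have hu2 : HasDerivAt (deriv u) (deriv (deriv u) t₀) t₀ :=
    ((huS.derivWithin (m := ∞) le_rfl).differentiableAt (by simp)).hasDerivAt
  have hu1 : deriv u t₀ = vec (velocity (I := I) γ t₀) := by
    rw [hderiv.self_of_nhds.deriv]
    exact tangentCoordChange_self (mem_extChartAt_source _)
  have hX : deriv (deriv u) t₀ = -christoffel g (γ t₀) (vec (velocity (I := I) γ t₀))
      (vec (velocity (I := I) γ t₀)) := by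
    rw [← hu1]
    exact eq_neg_of_add_eq_zero_left hγ
  have hF : HasDerivAt (fun t => (u t, deriv u t)) (vec (velocity (I := I) γ t₀),
      -christoffel g (γ t₀) (vec (velocity (I := I) γ t₀)) (vec (velocity (I := I) γ t₀))) t₀ := by
    rw [← hX, ← hu1]
    exact (hderiv.self_of_nhds.differentiableAt.hasDerivAt).prodMk hu2
  have hcont : ContinuousAt (velocity (I := I) γ) t₀ := by
    have h1 : Continuous (tangentMap 𝓘(ℝ, ℝ) I γ) :=
      (hs.contMDiff_tangentMap (m := ∞) le_rfl).continuous
    have h2 : ContMDiff 𝓘(ℝ, ℝ) 𝓘(ℝ, ℝ).tangent ∞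
        (fun t : ℝ => (⟨t, (1 : ℝ)⟩ : TangentBundle 𝓘(ℝ, ℝ) ℝ)) :=
      (contMDiff_vectorSpace_iff_contDiff (V := fun _ => (1 : ℝ))).2 contDiff_const
    exact (h1.comp h2.continuous).continuousAt
  refine hasMFDerivAt_of_chart _ hcont hF.hasFDerivAt ?_
  filter_upwards [hderiv] with t ht
  rw [extChartAt_tangent_eq]
  exact Prod.ext rfl ht.deriv.symm

/-- The pairing `g_x(d_θ π ξ, v)` of a tangent vector `ξ` at `θ = (x, v)` with the geodesic vector
field. -/
def contactForm (g : Metric I M) (θ : TangentBundle I M) (ξ : E × E) : ℝ :=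
  metricForm g θ.1 ξ.1 (vec θ)

/-- First variation along a geodesic, in coordinates. -/
lemma exists_hasDerivAt_variation (g : Metric I M) (x : M) {u : ℝ × ℝ → E} {t₀ : ℝ}
    (hu : ContDiffAt ℝ ∞ u (0, t₀)) (hx : u (0, t₀) = extChartAt I x x)
    (hgeo : deriv (deriv fun t => u (0, t)) t₀ + christoffel g x (deriv (fun t => u (0, t)) t₀)
      (deriv (fun t => u (0, t)) t₀) = 0) :
    ∃ e : ℝ, HasDerivAt (fun s => coordMetric g x (u (s, t₀)) (fderiv ℝ u (s, t₀) (0, 1))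
        (fderiv ℝ u (s, t₀) (0, 1))) e 0 ∧
      HasDerivAt (fun t => coordMetric g x (u (0, t)) (fderiv ℝ u (0, t) (1, 0))
        (fderiv ℝ u (0, t) (0, 1))) (e / 2) t₀ := by
  set p₀ : ℝ × ℝ := (0, t₀) with hp₀
  have hu0 : HasFDerivAt u (fderiv ℝ u p₀) p₀ := (hu.differentiableAt (by simp)).hasFDerivAt
  have hu1 : HasFDerivAt (fderiv ℝ u) (fderiv ℝ (fderiv ℝ u) p₀) p₀ :=
    ((hu.fderiv_right (m := ∞) le_rfl).differentiableAt (by simp)).hasFDerivAt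
  have hsymm : IsSymmSndFDerivAt ℝ u p₀ := hu.isSymmSndFDerivAt (by simpa using ENat.LEInfty.out)
  have hls : HasDerivAt (fun s : ℝ => (s, t₀)) ((1 : ℝ), (0 : ℝ)) 0 :=
    (hasDerivAt_id _).prodMk (hasDerivAt_const _ _)
  have hlt : HasDerivAt (fun t : ℝ => ((0 : ℝ), t)) ((0 : ℝ), (1 : ℝ)) t₀ :=
    (hasDerivAt_const _ _).prodMk (hasDerivAt_id _)
  have hus : HasDerivAt (fun s => u (s, t₀)) (fderiv ℝ u p₀ (1, 0)) 0 :=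
    HasFDerivAt.comp_hasDerivAt (f := fun s : ℝ => (s, t₀)) 0 hu0 hls
  have hut : HasDerivAt (fun t => u (0, t)) (fderiv ℝ u p₀ (0, 1)) t₀ :=
    HasFDerivAt.comp_hasDerivAt (f := fun t : ℝ => ((0 : ℝ), t)) t₀ hu0 hlt
  have hDs (w : ℝ × ℝ) : HasDerivAt (fun s => fderiv ℝ u (s, t₀) w)
      (fderiv ℝ (fderiv ℝ u) p₀ (1, 0) w) 0 := by
    have := HasFDerivAt.comp_hasDerivAt (f := fun s : ℝ => (s, t₀)) 0 hu1 hls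
    simpa using this.clm_apply (hasDerivAt_const _ w)
  have hDt (w : ℝ × ℝ) : HasDerivAt (fun t => fderiv ℝ u (0, t) w)
      (fderiv ℝ (fderiv ℝ u) p₀ (0, 1) w) t₀ := by
    have := HasFDerivAt.comp_hasDerivAt (f := fun t : ℝ => ((0 : ℝ), t)) t₀ hu1 hlt
    simpa using this.clm_apply (hasDerivAt_const _ w)
  have hev : (deriv fun t => u (0, t)) =ᶠ[𝓝 t₀] fun t => fderiv ℝ u (0, t) (0, 1) := by
    have hd : ∀ᶠ p in 𝓝 p₀, DifferentiableAt ℝ u p :=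
      ((hu.of_le (m := 1) ENat.LEInfty.out).eventually (by simp)).mono fun p hp => hp.differentiableAt (by simp)
    filter_upwards [(hlt.continuousAt.tendsto).eventually hd] with t ht
    exact (HasFDerivAt.comp_hasDerivAt (f := fun t : ℝ => ((0 : ℝ), t)) t ht.hasFDerivAt
      ((hasDerivAt_const _ _).prodMk (hasDerivAt_id _))).deriv
  have hX : fderiv ℝ (fderiv ℝ u) p₀ (0, 1) (0, 1) =
      -christoffel g x (fderiv ℝ u p₀ (0, 1)) (fderiv ℝ u p₀ (0, 1)) := by
    rw [hev.deriv_eq, (hDt (0, 1)).deriv, hut.deriv] at hgeo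
    exact eq_neg_of_add_eq_zero_left hgeo
  refine ⟨_, hasDerivAt_coordMetric g x hus (hDs (0, 1)) (hDs (0, 1)) hx, ?_⟩
  refine (hasDerivAt_coordMetric g x hut (hDt (1, 0)) (hDt (0, 1)) hx).congr_deriv ?_
  rw [hX, hsymm.eq (0, 1) (1, 0), map_neg, metricForm_symm g x (fderiv ℝ u p₀ (1, 0)),
    metricForm_symm g x (fderiv ℝ u p₀ (0, 1)) (fderiv ℝ (fderiv ℝ u) p₀ (1, 0) (0, 1)),
    ← hp₀, metricForm_christoffel_self,
    coordMetricDeriv_symm g x _ (fderiv ℝ u p₀ (1, 0))]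
  ring

end Geodesics

section Flow

variable {E : Type*} [NormedAddCommGroup E] [NormedSpace ℝ E]
  {H : Type*} [TopologicalSpace H] {I : ModelWithCorners ℝ E H} [I.Boundaryless]
  {M : Type*} [TopologicalSpace M] [ChartedSpace H M] [IsManifold I ∞ M]

instance [T2Space M] : T2Space (TangentBundle I M) := by
  refine ⟨fun θ η hne => ?_⟩
  by_cases h : θ.1 = η.1
  · let e := trivializationAt E (TangentSpace I : M → Type _) θ.1
    have hθ : θ ∈ e.source := e.mem_source.2 (mem_baseSet_trivializationAt _ _ θ.1)
    have hη : η ∈ e.source := e.mem_source.2 (h ▸ mem_baseSet_trivializationAt _ _ θ.1)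
    obtain ⟨U, V, hU, hV, hθU, hηV, hUV⟩ := t2_separation
      (fun he => hne (e.toPartialEquiv.injOn hθ hη he) : e θ ≠ e η)
    refine ⟨e.source ∩ e ⁻¹' U, e.source ∩ e ⁻¹' V,
      e.continuousOn_toFun.isOpen_inter_preimage e.open_source hU,
      e.continuousOn_toFun.isOpen_inter_preimage e.open_source hV, ⟨hθ, hθU⟩, ⟨hη, hηV⟩, ?_⟩
    exact (hUV.preimage e).mono inter_subset_right inter_subset_right
  · exact separated_by_continuous (FiberBundle.continuous_proj E (TangentSpace I)) h

variable [FiniteDimensional ℝ E]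
  {g : Metric I M} {φ : ℝ → TangentBundle I M → TangentBundle I M}

namespace IsGeodesicFlow

lemma isMIntegralCurve (hφ : IsGeodesicFlow g φ) (θ : TangentBundle I M) :
    IsMIntegralCurve (I := I.tangent) (fun t => φ t θ) (geodesicField g) := by
  obtain ⟨γ, hγ, -, h⟩ := hφ.2 θ
  rw [show (fun t => φ t θ) = velocity (I := I) γ from funext h]
  exact hγ.isMIntegralCurve

lemma map_zero (hφ : IsGeodesicFlow g φ) (θ : TangentBundle I M) : φ 0 θ = θ := by
  obtain ⟨γ, -, h0, h⟩ := hφ.2 θ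
  rw [h, h0]

lemma contMDiff_time (hφ : IsGeodesicFlow g φ) (t : ℝ) :
    ContMDiff I.tangent I.tangent ∞ (φ t) :=
  hφ.1.comp (contMDiff_const.prodMk contMDiff_id)

lemma mdifferentiableAt (hφ : IsGeodesicFlow g φ) (t : ℝ) (θ : TangentBundle I M) :
    MDifferentiableAt I.tangent I.tangent (φ t) θ :=
  (hφ.contMDiff_time t θ).mdifferentiableAt (by simp)

lemma contMDiff_geodesicField (hφ : IsGeodesicFlow g φ) :
    ContMDiff I.tangent I.tangent.tangent ∞ (fun θ : TangentBundle I M =>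
      (⟨θ, geodesicField g θ⟩ : TangentBundle I.tangent (TangentBundle I M))) := by
  have h1 := hφ.1.contMDiff_tangentMap (m := ∞) le_rfl
  have h2 : ContMDiff I.tangent 𝓘(ℝ, ℝ).tangent ∞ (fun _ : TangentBundle I M =>
      (⟨0, (1 : ℝ)⟩ : TangentBundle 𝓘(ℝ, ℝ) ℝ)) := contMDiff_const
  have h3 : ContMDiff I.tangent I.tangent.tangent ∞ (fun θ : TangentBundle I M =>
      (⟨θ, 0⟩ : TangentBundle I.tangent (TangentBundle I M))) :=
    Bundle.contMDiff_zeroSection ℝ (TangentSpace I.tangent : TangentBundle I M → Type _)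
  have h4 := (contMDiff_equivTangentBundleProd_symm (I := 𝓘(ℝ, ℝ)) (M := ℝ) (I' := I.tangent)
    (M' := TangentBundle I M) (n := ∞)).comp (h2.prodMk h3)
  convert h1.comp h4 using 1
  funext θ
  have hF : MDifferentiableAt (𝓘(ℝ, ℝ).prod I.tangent) I.tangent
      (fun p : ℝ × TangentBundle I M => φ p.1 p.2) (0, θ) :=
    (hφ.1 _).mdifferentiableAt (by simp)
  have hl := (hasMFDerivAt_id (I := 𝓘(ℝ, ℝ)) (0 : ℝ)).prodMk
    (hasMFDerivAt_const (I := 𝓘(ℝ, ℝ)) (I' := I.tangent) θ (0 : ℝ))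
  have hc := hF.hasMFDerivAt.comp (0 : ℝ) hl
  have hu := hasMFDerivAt_unique (hφ.isMIntegralCurve θ 0) hc
  have hu' := congrArg (fun L : ℝ →L[ℝ] E × E => L 1) hu
  have hX : (1 : ℝ) • geodesicField g (φ 0 θ) =
      mfderiv (𝓘(ℝ, ℝ).prod I.tangent) I.tangent
        (fun p : ℝ × TangentBundle I M => φ p.1 p.2) (0, θ) ((1 : ℝ), (0 : E × E)) := hu'
  rw [one_smul] at hX
  have hθ : (⟨θ, geodesicField g θ⟩ : TangentBundle I.tangent (TangentBundle I M)) =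
      ⟨φ 0 θ, geodesicField g (φ 0 θ)⟩ := by rw [hφ.map_zero]
  rw [hθ, hX]
  rfl

lemma normSq_map (hφ : IsGeodesicFlow g φ) (t : ℝ) (θ : TangentBundle I M) :
    normSq g (φ t θ) = normSq g θ := by
  have h : ∀ t, HasDerivAt (fun t => normSq g (φ t θ)) 0 t := fun t => by
    have h1 := (mdifferentiableAt_normSq g (φ t θ)).hasMFDerivAt.comp t (hφ.isMIntegralCurve θ t)
    rw [hasDerivAt_iff_hasFDerivAt]
    refine (hasMFDerivAt_iff_hasFDerivAt.1 h1).congr_fderiv (ContinuousLinearMap.ext_ring ?_)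
    change mfderiv I.tangent 𝓘(ℝ, ℝ) (normSq g) (φ t θ) ((1 : ℝ) • geodesicField g (φ t θ))
      = (1 : ℝ) • (0 : ℝ)
    rw [one_smul, smul_zero]
    have := mfderiv_normSq_apply g (φ t θ) (geodesicField g (φ t θ))
    rw [this, show ((geodesicField g (φ t θ) : E × E).2 + christoffel g (φ t θ).proj
      (geodesicField g (φ t θ) : E × E).1 (vec (φ t θ)) : E) = 0 from neg_add_cancel _]
    simp only [_root_.map_zero, LinearMap.zero_apply]
    exact mul_zero (2 : ℝ)
  have := is_const_of_deriv_eq_zero (fun t => (h t).differentiableAt) (fun t => (h t).deriv) t 0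
  simpa only [hφ.map_zero] using this

lemma mfderiv_normSq_flowDeriv (hφ : IsGeodesicFlow g φ) (t : ℝ) (θ : TangentBundle I M)
    (ξ : TangentSpace I.tangent θ) :
    mfderiv I.tangent 𝓘(ℝ, ℝ) (normSq g) (φ t θ) (flowDeriv φ t θ ξ) =
      mfderiv I.tangent 𝓘(ℝ, ℝ) (normSq g) θ ξ := by
  have h := (mdifferentiableAt_normSq g (φ t θ)).hasMFDerivAt.comp θ
    (hφ.mdifferentiableAt t θ).hasMFDerivAt
  have e : normSq g ∘ φ t = normSq g := funext fun η => hφ.normSq_map t η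
  rw [e] at h
  rw [h.mfderiv]
  rfl

lemma hasDerivAt_extChartAt (hφ : IsGeodesicFlow g φ) (x : M) (θ : TangentBundle I M) {t : ℝ}
    (ht : (φ t θ).1 ∈ (extChartAt I x).source) :
    HasDerivAt (fun s => extChartAt I x (φ s θ).1)
      (tangentCoordChange I (φ t θ).1 x (φ t θ).1 (vec (φ t θ))) t := by
  obtain ⟨γ, hγ, -, h⟩ := hφ.2 θ
  simp only [h] at ht ⊢
  exact hasDerivAt_extChartAt_comp x
    (hasMFDerivAt_velocity ((hγ.1 t).mdifferentiableAt (by simp))) ht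

/-- The geodesic equation in the chart at `(φ t₀ θ).1`. -/
lemma deriv_deriv_extChartAt (hφ : IsGeodesicFlow g φ) (θ : TangentBundle I M) (t₀ : ℝ) :
    letI u : ℝ → E := fun t => extChartAt I (φ t₀ θ).1 (φ t θ).1
    deriv (deriv u) t₀ + christoffel g (φ t₀ θ).1 (deriv u t₀) (deriv u t₀) = 0 := by
  obtain ⟨γ, hγ, -, h⟩ := hφ.2 θ
  simp only [h]
  exact hγ.2 t₀

lemma hasDerivAt_contactForm (hφ : IsGeodesicFlow g φ) {θ : TangentBundle I M}
    {ξ : TangentSpace I.tangent θ} (hξ : mfderiv I.tangent 𝓘(ℝ, ℝ) (normSq g) θ ξ = (0 : ℝ))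
    (t₀ : ℝ) :
    HasDerivAt (fun t => contactForm g (φ t θ) (flowDeriv φ t θ ξ)) 0 t₀ := by
  obtain ⟨c, hc, rfl, hc'⟩ := exists_curve (I := I.tangent) θ ξ
  set x := (φ t₀ (c 0)).1 with hx
  let u : ℝ × ℝ → E := fun p => extChartAt I x (φ p.2 (c p.1)).1
  have hf : ContMDiffAt 𝓘(ℝ, ℝ × ℝ) I.tangent ∞ (fun p : ℝ × ℝ => φ p.2 (c p.1)) (0, t₀) :=
    (hφ.1 (t₀, c 0)).comp (0, t₀) ((contDiff_snd.contMDiff.contMDiffAt).prodMk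
      (hc.comp (0, t₀) contDiff_fst.contMDiff.contMDiffAt))
  have hπ : ContMDiff I.tangent I ∞ (TotalSpace.proj : TangentBundle I M → M) :=
    contMDiff_proj (TangentSpace I)
  have hu : ContDiffAt ℝ ∞ u (0, t₀) := by
    rw [← contMDiffAt_iff_contDiffAt]
    exact (contMDiffAt_extChartAt (n := ∞) (x := x)).comp (0, t₀) ((hπ _).comp (0, t₀) hf)
  have hsrc : ∀ᶠ p in 𝓝 ((0 : ℝ), t₀), (φ p.2 (c p.1)).1 ∈ (extChartAt I x).source :=
    ((hπ.continuous.continuousAt).comp hf.continuousAt).preimage_mem_nhds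
      (extChartAt_source_mem_nhds _)
  have hud : ∀ᶠ p in 𝓝 ((0 : ℝ), t₀), DifferentiableAt ℝ u p :=
    ((hu.of_le (m := 1) ENat.LEInfty.out).eventually (by simp)).mono
      fun p hp => hp.differentiableAt (by simp)
  have hT : ∀ᶠ p in 𝓝 ((0 : ℝ), t₀), fderiv ℝ u p (0, 1) = tangentCoordChange I
      (φ p.2 (c p.1)).1 x (φ p.2 (c p.1)).1 (vec (φ p.2 (c p.1))) := by
    filter_upwards [hud, hsrc] with ⟨s, t⟩ hp hp'
    exact (HasFDerivAt.comp_hasDerivAt (f := fun t : ℝ => (s, t)) t hp.hasFDerivAt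
      ((hasDerivAt_const _ _).prodMk (hasDerivAt_id _))).unique
      (hφ.hasDerivAt_extChartAt x (c s) hp')
  have hls : ContinuousAt (fun s : ℝ => (s, t₀)) 0 := by fun_prop
  have hlt : ContinuousAt (fun t : ℝ => ((0 : ℝ), t)) t₀ := by fun_prop
  have hS : ∀ᶠ t in 𝓝 t₀, fderiv ℝ u (0, t) (1, 0) = tangentCoordChange I
      (φ t (c 0)).1 x (φ t (c 0)).1 (flowDeriv φ t (c 0) ξ : E × E).1 := by
    filter_upwards [hlt.eventually hud, hlt.eventually hsrc] with t hp hp'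
    have h1 := (HasFDerivAt.comp_hasDerivAt (f := fun s : ℝ => (s, t)) 0 hp.hasFDerivAt
      ((hasDerivAt_id _).prodMk (hasDerivAt_const _ _)))
    have h2 := ((hπ (φ t (c 0))).mdifferentiableAt (by simp)).hasMFDerivAt.comp (c 0)
      (hφ.mdifferentiableAt t (c 0)).hasMFDerivAt
    have h3 := h2.comp (0 : ℝ) hc'
    refine h1.unique (hasDerivAt_extChartAt_comp (γ := fun s => (φ t (c s)).1) x ?_ hp')
    refine h3.congr_mfderiv (ContinuousLinearMap.ext_ring ?_)
    change dProj (φ t (c 0)) (flowDeriv φ t (c 0) ((1 : ℝ) • ξ)) = (1 : ℝ) • _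
    rw [one_smul]
    exact (dProj_apply _ _).trans (one_smul ℝ (_ : E)).symm
  obtain ⟨e, he, hα⟩ := exists_hasDerivAt_variation g x hu rfl
    (hφ.deriv_deriv_extChartAt (c 0) t₀)
  have he' : e = 0 := by
    have h1 : HasDerivAt (fun s => normSq g (c s)) 0 0 := by
      have h1 := (mdifferentiableAt_normSq g (c 0)).hasMFDerivAt.comp (0 : ℝ) hc'
      rw [hasDerivAt_iff_hasFDerivAt]
      refine (hasMFDerivAt_iff_hasFDerivAt.1 h1).congr_fderiv (ContinuousLinearMap.ext_ring ?_)
      change mfderiv I.tangent 𝓘(ℝ, ℝ) (normSq g) (c 0) ((1 : ℝ) • ξ) = (1 : ℝ) • (0 : ℝ)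
      rw [one_smul, smul_zero]
      exact hξ
    refine he.unique (h1.congr_of_eventuallyEq ?_)
    filter_upwards [hls.eventually hT, hls.eventually hsrc] with s hs hs'
    rw [hs, ← hφ.normSq_map t₀ (c s)]
    exact (inner_eq_coordMetric g hs' _ _).symm
  rw [he', zero_div] at hα
  refine hα.congr_of_eventuallyEq ?_
  filter_upwards [hlt.eventually hT, hlt.eventually hsrc, hS] with t h1 h2 h3
  rw [h1, h3]
  exact inner_eq_coordMetric g h2 _ _

lemma contactForm_flowDeriv (hφ : IsGeodesicFlow g φ) {θ : TangentBundle I M}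
    {ξ : TangentSpace I.tangent θ} (hξ : mfderiv I.tangent 𝓘(ℝ, ℝ) (normSq g) θ ξ = (0 : ℝ))
    (t : ℝ) : contactForm g (φ t θ) (flowDeriv φ t θ ξ) = contactForm g θ ξ := by
  have h := is_const_of_deriv_eq_zero
    (fun t => (hφ.hasDerivAt_contactForm hξ t).differentiableAt)
    (fun t => (hφ.hasDerivAt_contactForm hξ t).deriv) t 0
  have h0 : tangentMap I.tangent I.tangent (φ 0) ⟨θ, ξ⟩ = ⟨θ, ξ⟩ := by
    rw [show φ 0 = id from funext hφ.map_zero, tangentMap_id]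
    rfl
  exact h.trans (congrArg (fun ζ : TangentBundle I.tangent (TangentBundle I M) =>
    contactForm g ζ.1 ζ.2) h0)

variable [T2Space M]

lemma eq_of_isMIntegralCurve (hφ : IsGeodesicFlow g φ) {c : ℝ → TangentBundle I M}
    (hc : IsMIntegralCurve (I := I.tangent) c (geodesicField g)) (t : ℝ) :
    c t = φ t (c 0) := by
  have h := isMIntegralCurve_Ioo_eq_of_contMDiff_boundaryless (t₀ := 0)
    (hφ.contMDiff_geodesicField.of_le (n := ∞) (m := 1) ENat.LEInfty.out) hc
    (hφ.isMIntegralCurve (c 0)) (hφ.map_zero (c 0)).symm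
  exact congrFun h t

lemma map_add (hφ : IsGeodesicFlow g φ) (s t : ℝ) (θ : TangentBundle I M) :
    φ (s + t) θ = φ s (φ t θ) := by
  have h := hφ.eq_of_isMIntegralCurve ((hφ.isMIntegralCurve θ).comp_add t) s
  simpa using h

lemma tangentMap_neg_tangentMap (hφ : IsGeodesicFlow g φ) (t : ℝ) (θ : TangentBundle I M)
    (ξ : TangentSpace I.tangent θ) :
    tangentMap I.tangent I.tangent (φ (-t)) (tangentMap I.tangent I.tangent (φ t) ⟨θ, ξ⟩) =
      ⟨θ, ξ⟩ := by
  have h := tangentMap_comp_at (⟨θ, ξ⟩ : TangentBundle I.tangent (TangentBundle I M))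
    (hφ.mdifferentiableAt (-t) (φ t θ)) (hφ.mdifferentiableAt t θ)
  rw [← h, show φ (-t) ∘ φ t = id from funext fun η => by
    simp only [Function.comp, ← hφ.map_add, neg_add_cancel, hφ.map_zero, id], tangentMap_id]
  rfl

end IsGeodesicFlow

end Flow

section Sasaki

variable {E : Type*} [NormedAddCommGroup E] [NormedSpace ℝ E] [FiniteDimensional ℝ E]
  {H : Type*} [TopologicalSpace H] {I : ModelWithCorners ℝ E H} [I.Boundaryless]
  {M : Type*} [TopologicalSpace M] [ChartedSpace H M] [IsManifold I ∞ M]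

/-- The connection map in coordinates, as a linear map. -/
def connectionLinear (g : Metric I M) (θ : TangentBundle I M) : E × E →ₗ[ℝ] E where
  toFun ξ := ξ.2 + christoffel g θ.1 ξ.1 (vec θ)
  map_add' ξ η := by
    simp only [Prod.fst_add, Prod.snd_add, christoffel_add_left]
    abel
  map_smul' c ξ := by
    have := christoffel_smul_smul g θ.1 c 1 ξ.1 (vec θ)
    rw [one_smul, mul_one] at this
    simp only [Prod.smul_fst, Prod.smul_snd, RingHom.id_apply, smul_add, this]

/-- The Sasaki metric at `θ`, as a bilinear form in coordinates. -/
def sasakiForm (g : Metric I M) (θ : TangentBundle I M) : LinearMap.BilinForm ℝ (E × E) :=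
  (metricForm g θ.1).compl₁₂ (LinearMap.fst ℝ E E) (LinearMap.fst ℝ E E) +
    (metricForm g θ.1).compl₁₂ (connectionLinear g θ) (connectionLinear g θ)

lemma sasakiForm_apply (g : Metric I M) (θ : TangentBundle I M) (ξ η : E × E) :
    sasakiForm g θ ξ η = metricForm g θ.1 ξ.1 η.1 +
      metricForm g θ.1 (ξ.2 + christoffel g θ.1 ξ.1 (vec θ))
        (η.2 + christoffel g θ.1 η.1 (vec θ)) := rfl

lemma sasakiForm_symm (g : Metric I M) (θ : TangentBundle I M) (ξ η : E × E) :
    sasakiForm g θ ξ η = sasakiForm g θ η ξ := by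
  rw [sasakiForm_apply, sasakiForm_apply, metricForm_symm, metricForm_symm g θ.1 (_ + _)]

lemma sasakiForm_self_nonneg (g : Metric I M) (θ : TangentBundle I M) (ξ : E × E) :
    0 ≤ sasakiForm g θ ξ ξ :=
  add_nonneg (metricForm_nonneg _ _ _) (metricForm_nonneg _ _ _)

lemma eq_zero_of_sasakiForm_self_le (g : Metric I M) (θ : TangentBundle I M) {ξ : E × E}
    (h : sasakiForm g θ ξ ξ ≤ 0) : ξ = 0 := by
  rw [sasakiForm_apply] at h
  have h1 := metricForm_nonneg g θ.1 ξ.1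
  have h2 := metricForm_nonneg g θ.1 (ξ.2 + christoffel g θ.1 ξ.1 (vec θ))
  have h3 : ξ.1 = 0 := eq_zero_of_metricForm_eq_zero g θ.1 (by linarith)
  have h4 := eq_zero_of_metricForm_eq_zero g θ.1 (a := ξ.2 + christoffel g θ.1 ξ.1 (vec θ))
    (by linarith)
  have h5 := christoffel_smul_smul g θ.1 0 1 0 (vec θ)
  rw [one_smul, zero_smul, zero_mul, zero_smul] at h5
  rw [h3, h5, add_zero] at h4
  exact Prod.ext h3 h4

lemma sasakiForm_sub_self_le (g : Metric I M) (θ : TangentBundle I M) (ξ η : E × E) :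
    sasakiForm g θ (ξ - η) (ξ - η) ≤ 2 * sasakiForm g θ ξ ξ + 2 * sasakiForm g θ η η := by
  have h := sasakiForm_self_nonneg g θ (ξ + η)
  simp only [map_add, map_sub, LinearMap.add_apply, LinearMap.sub_apply] at h ⊢
  linarith

lemma sasakiNorm_eq (g : Metric I M) (θ : TangentBundle I M) (ξ : E × E) :
    sasakiNorm g θ ξ = √(sasakiForm g θ ξ ξ) := by
  unfold sasakiNorm
  rw [dProj_apply]
  rfl

/-- The differential of `normSq` in coordinates. -/
def normSqDeriv (g : Metric I M) (θ : TangentBundle I M) : E × E →L[ℝ] ℝ :=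
  mfderiv I.tangent 𝓘(ℝ, ℝ) (normSq g) θ

lemma normSqDeriv_apply (g : Metric I M) (θ : TangentBundle I M) (ξ : E × E) :
    normSqDeriv g θ ξ = 2 * metricForm g θ.1 (ξ.2 + christoffel g θ.1 ξ.1 (vec θ)) (vec θ) :=
  mfderiv_normSq_apply g θ ξ

lemma metricForm_sq_le (g : Metric I M) {θ : TangentBundle I M} (hθ : θ ∈ unitBundle g) (a : E) :
    metricForm g θ.1 a (vec θ) ^ 2 ≤ metricForm g θ.1 a a := by
  have hv : metricForm g θ.1 (vec θ) (vec θ) = 1 := hθ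
  have h := metricForm_nonneg g θ.1 (a - metricForm g θ.1 a (vec θ) • vec θ)
  simp only [map_sub, map_smul, LinearMap.sub_apply, LinearMap.smul_apply, smul_eq_mul, hv,
    metricForm_symm g θ.1 (vec θ) a] at h
  nlinarith

lemma contactForm_sq_le (g : Metric I M) {θ : TangentBundle I M} (hθ : θ ∈ unitBundle g)
    (ξ : E × E) : contactForm g θ ξ ^ 2 ≤ sasakiForm g θ ξ ξ :=
  (metricForm_sq_le g hθ ξ.1).trans (le_add_of_nonneg_right (metricForm_nonneg _ _ _))

lemma normSqDeriv_sq_le (g : Metric I M) {θ : TangentBundle I M} (hθ : θ ∈ unitBundle g)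
    (ξ : E × E) : normSqDeriv g θ ξ ^ 2 ≤ 4 * sasakiForm g θ ξ ξ := by
  rw [normSqDeriv_apply, mul_pow]
  have h1 := metricForm_sq_le g hθ (ξ.2 + christoffel g θ.1 ξ.1 (vec θ))
  have h2 := metricForm_nonneg g θ.1 ξ.1
  rw [sasakiForm_apply]
  linarith

/-- The geodesic vector field in coordinates. -/
def geodesicCoord (g : Metric I M) (θ : TangentBundle I M) : E × E :=
  (vec θ, -christoffel g θ.1 (vec θ) (vec θ))

lemma sasakiForm_geodesicCoord (g : Metric I M) (θ : TangentBundle I M) (ξ : E × E) :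
    sasakiForm g θ ξ (geodesicCoord g θ) = contactForm g θ ξ := by
  rw [sasakiForm_apply]
  simp [geodesicCoord, contactForm]

lemma contactForm_geodesicCoord (g : Metric I M) {θ : TangentBundle I M}
    (hθ : θ ∈ unitBundle g) : contactForm g θ (geodesicCoord g θ) = 1 := hθ

lemma contactForm_add (g : Metric I M) (θ : TangentBundle I M) (ξ η : E × E) :
    contactForm g θ (ξ + η) = contactForm g θ ξ + contactForm g θ η := by
  simp [contactForm]

lemma contactForm_smul (g : Metric I M) (θ : TangentBundle I M) (c : ℝ) (ξ : E × E) :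
    contactForm g θ (c • ξ) = c * contactForm g θ ξ := by
  simp [contactForm]

/-- The class modulo the geodesic vector field of a vector given in coordinates. -/
def quotCoord (g : Metric I M) (θ : TangentBundle I M) (ξ : E × E) : FlowQuot g θ :=
  toQuot g θ ξ

lemma quotCoord_eq_iff (g : Metric I M) (θ : TangentBundle I M) (ξ η : E × E) :
    quotCoord g θ ξ = quotCoord g θ η ↔ ∃ c : ℝ, ξ - η = c • geodesicCoord g θ := by
  have := Submodule.Quotient.eq (x := (ξ : TangentSpace I.tangent θ))
    (y := (η : TangentSpace I.tangent θ)) (Submodule.span ℝ {geodesicField g θ})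
  refine this.trans (Submodule.mem_span_singleton.trans ?_)
  exact exists_congr fun c => eq_comm

lemma quotCoord_injOn (g : Metric I M) {θ : TangentBundle I M} (hθ : θ ∈ unitBundle g)
    {ξ η : E × E} (hξ : contactForm g θ ξ = 0) (hη : contactForm g θ η = 0)
    (h : quotCoord g θ ξ = quotCoord g θ η) : ξ = η := by
  obtain ⟨c, hc⟩ := (quotCoord_eq_iff g θ ξ η).1 h
  have h1 : ξ = η + c • geodesicCoord g θ := by rw [← hc]; abel
  have h2 := congrArg (contactForm g θ) h1
  rw [contactForm_add, contactForm_smul, hξ, hη, contactForm_geodesicCoord g hθ] at h2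
  have : c = 0 := by linarith
  simpa [this] using h1

lemma quotNorm_quotCoord (g : Metric I M) (θ : TangentBundle I M) {ξ : E × E}
    (hξ : contactForm g θ ξ = 0) :
    quotNorm g θ (quotCoord g θ ξ) = √(sasakiForm g θ ξ ξ) := by
  refine IsLeast.csInf_eq ⟨⟨ξ, rfl, sasakiNorm_eq g θ ξ⟩, ?_⟩
  rintro _ ⟨(η : E × E), hη, rfl⟩
  obtain ⟨c, hc⟩ := (quotCoord_eq_iff g θ η ξ).1 hη
  rw [sasakiNorm_eq]
  refine Real.sqrt_le_sqrt ?_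
  have h1 : η = ξ + c • geodesicCoord g θ := by rw [← hc]; abel
  have h2 := sasakiForm_self_nonneg g θ (c • geodesicCoord g θ)
  rw [h1]
  simp only [map_add, LinearMap.add_apply, map_smul, LinearMap.smul_apply, smul_eq_mul,
    sasakiForm_symm g θ (geodesicCoord g θ) ξ, sasakiForm_geodesicCoord, hξ] at h2 ⊢
  linarith

lemma normSqDeriv_geodesicCoord (g : Metric I M) (θ : TangentBundle I M) :
    normSqDeriv g θ (geodesicCoord g θ) = 0 := by
  rw [normSqDeriv_apply]
  simp [geodesicCoord]

lemma exists_lift (g : Metric I M) {θ : TangentBundle I M} (hθ : θ ∈ unitBundle g)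
    {q : FlowQuot g θ} (hq : q ∈ unitQuot g θ) : ∃ ξ : E × E, quotCoord g θ ξ = q ∧
      contactForm g θ ξ = 0 ∧ normSqDeriv g θ ξ = 0 := by
  obtain ⟨(ξ : E × E), (hξ : normSqDeriv g θ ξ = 0), rfl⟩ := hq
  refine ⟨ξ - contactForm g θ ξ • geodesicCoord g θ, ?_, ?_, ?_⟩
  · refine (quotCoord_eq_iff g θ _ ξ).2 ⟨-contactForm g θ ξ, ?_⟩
    simp
  · rw [sub_eq_add_neg, ← neg_smul, contactForm_add, contactForm_smul,
      contactForm_geodesicCoord g hθ]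
    ring
  · rw [map_sub, map_smul, normSqDeriv_geodesicCoord, hξ]
    simp

lemma normSqDeriv_eq_zero (g : Metric I M) {θ : TangentBundle I M} {ξ : E × E}
    (hq : quotCoord g θ ξ ∈ unitQuot g θ) : normSqDeriv g θ ξ = 0 := by
  obtain ⟨(η : E × E), (hη : normSqDeriv g θ η = 0), h⟩ := hq
  obtain ⟨c, hc⟩ := (quotCoord_eq_iff g θ ξ η).1 h.symm
  have h1 : ξ = η + c • geodesicCoord g θ := by rw [← hc]; abel
  rw [h1, map_add, map_smul, normSqDeriv_geodesicCoord, hη]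
  simp

/-- The differential of the flow in coordinates. -/
def flowCoord (φ : ℝ → TangentBundle I M → TangentBundle I M) (t : ℝ) (θ : TangentBundle I M) :
    E × E →L[ℝ] E × E :=
  flowDeriv φ t θ

/-- The square of the Sasaki norm of `d_θ φ_t ξ`. -/
def growth (g : Metric I M) (φ : ℝ → TangentBundle I M → TangentBundle I M)
    (θ : TangentBundle I M) (t : ℝ) (ξ : E × E) : ℝ :=
  sasakiForm g (φ t θ) (flowCoord φ t θ ξ) (flowCoord φ t θ ξ)

lemma growth_nonneg (g : Metric I M) (φ : ℝ → TangentBundle I M → TangentBundle I M)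
    (θ : TangentBundle I M) (t : ℝ) (ξ : E × E) : 0 ≤ growth g φ θ t ξ :=
  sasakiForm_self_nonneg _ _ _

lemma growth_sub_le (g : Metric I M) (φ : ℝ → TangentBundle I M → TangentBundle I M)
    (θ : TangentBundle I M) (t : ℝ) (ξ η : E × E) :
    growth g φ θ t (ξ - η) ≤ 2 * growth g φ θ t ξ + 2 * growth g φ θ t η := by
  unfold growth
  rw [map_sub]
  exact sasakiForm_sub_self_le _ _ _ _

variable {g : Metric I M} {φ : ℝ → TangentBundle I M → TangentBundle I M}

lemma quotNorm_flowDeriv (hφ : IsGeodesicFlow g φ) {θ : TangentBundle I M} {ξ : E × E}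
    (hξ : contactForm g θ ξ = 0)
    (hξ' : normSqDeriv g θ ξ = 0) (t : ℝ) :
    quotNorm g (φ t θ) (toQuot g (φ t θ) (flowDeriv φ t θ ξ)) = √(growth g φ θ t ξ) :=
  quotNorm_quotCoord g (φ t θ) ((hφ.contactForm_flowDeriv hξ' t).trans hξ)

lemma map_mem_unitBundle (hφ : IsGeodesicFlow g φ) {θ : TangentBundle I M}
    (hθ : θ ∈ unitBundle g) (t : ℝ) : φ t θ ∈ unitBundle g :=
  (hφ.normSq_map t θ).trans hθ

lemma sqrt_le_mul_sqrt {a b c : ℝ} (hb : 0 ≤ b) (h : √a ≤ c * √b) (ha : 0 ≤ a) :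
    a ≤ c ^ 2 * b := by
  have h1 := mul_self_le_mul_self (Real.sqrt_nonneg a) h
  rw [Real.mul_self_sqrt ha] at h1
  calc a ≤ c * √b * (c * √b) := h1
    _ = c ^ 2 * (√b * √b) := by ring
    _ = c ^ 2 * b := by rw [Real.mul_self_sqrt hb]

lemma nonpos_of_le_exp {a K δ : ℝ} (hδ : δ < 0)
    (h : ∀ t : ℝ, 0 ≤ t → a ≤ K * Real.exp (t * δ) ^ 2) : a ≤ 0 := by
  have h1 : Filter.Tendsto (fun t : ℝ => K * Real.exp (t * δ) ^ 2) Filter.atTop (𝓝 (K * 0 ^ 2)) :=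
    ((Real.tendsto_exp_atBot.comp
      (Filter.tendsto_id.atTop_mul_const_of_neg hδ)).pow 2).const_mul K
  have h2 := ge_of_tendsto h1 (Filter.eventually_atTop.2 ⟨0, h⟩)
  simpa using h2

/-- The quotient norm of the class of a tangent vector of `TM`. -/
def totalQuotNorm (g : Metric I M) (ζ : TangentBundle I.tangent (TangentBundle I M)) : ℝ :=
  quotNorm g ζ.1 (toQuot g ζ.1 ζ.2)

namespace IsHyperbolicSplitting

variable {Es Ec Eu : Distribution g} {C lam mu : ℝ} {θ : TangentBundle I M} {ξ : E × E}

lemma le_unitQuot (h : IsHyperbolicSplitting g φ Es Ec Eu C lam mu) (hθ : θ ∈ unitBundle g) :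
    Es θ ≤ unitQuot g θ ∧ Ec θ ≤ unitQuot g θ ∧ Eu θ ≤ unitQuot g θ := by
  rw [← h.sup_eq θ hθ]
  exact ⟨le_sup_left.trans le_sup_left, le_sup_right.trans le_sup_left, le_sup_right⟩

lemma growth_stable_le (h : IsHyperbolicSplitting g φ Es Ec Eu C lam mu)
    (hφ : IsGeodesicFlow g φ) (hθ : θ ∈ unitBundle g) (hξ : contactForm g θ ξ = 0)
    (hE : quotCoord g θ ξ ∈ Es θ) {t : ℝ} (ht : 0 ≤ t) :
    growth g φ θ t ξ ≤ (C * Real.exp (t * lam)) ^ 2 * sasakiForm g θ ξ ξ := by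
  have h1 := h.contract_s t ht θ hθ ξ hE
  rw [quotNorm_flowDeriv hφ hξ (normSqDeriv_eq_zero g ((h.le_unitQuot hθ).1 hE))] at h1
  have h2 : quotNorm g θ (toQuot g θ ξ) = _ := quotNorm_quotCoord g θ hξ
  rw [h2] at h1
  exact sqrt_le_mul_sqrt (sasakiForm_self_nonneg _ _ _) h1 (growth_nonneg _ _ _ _ _)

lemma growth_center_le (h : IsHyperbolicSplitting g φ Es Ec Eu C lam mu)
    (hφ : IsGeodesicFlow g φ) (hθ : θ ∈ unitBundle g) (hξ : contactForm g θ ξ = 0)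
    (hE : quotCoord g θ ξ ∈ Ec θ) {t : ℝ} (ht : 0 ≤ t) :
    growth g φ θ t ξ ≤ (C * Real.exp (-(t * mu))) ^ 2 * sasakiForm g θ ξ ξ := by
  have h1 := h.center_upper t ht θ hθ ξ hE
  rw [quotNorm_flowDeriv hφ hξ (normSqDeriv_eq_zero g ((h.le_unitQuot hθ).2.1 hE))] at h1
  have h2 : quotNorm g θ (toQuot g θ ξ) = _ := quotNorm_quotCoord g θ hξ
  rw [h2] at h1
  exact sqrt_le_mul_sqrt (sasakiForm_self_nonneg _ _ _) h1 (growth_nonneg _ _ _ _ _)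

lemma le_growth_center (h : IsHyperbolicSplitting g φ Es Ec Eu C lam mu)
    (hφ : IsGeodesicFlow g φ) (hθ : θ ∈ unitBundle g) (hξ : contactForm g θ ξ = 0)
    (hE : quotCoord g θ ξ ∈ Ec θ) {t : ℝ} (ht : 0 ≤ t) :
    sasakiForm g θ ξ ξ ≤ (C * Real.exp (-(t * mu))) ^ 2 * growth g φ θ t ξ := by
  have h1 := h.center_lower t ht θ hθ ξ hE
  rw [quotNorm_flowDeriv hφ hξ (normSqDeriv_eq_zero g ((h.le_unitQuot hθ).2.1 hE))] at h1
  have h2 : quotNorm g θ (toQuot g θ ξ) = _ := quotNorm_quotCoord g θ hξ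
  rw [h2] at h1
  refine sqrt_le_mul_sqrt (growth_nonneg _ _ _ _ _) ?_ (sasakiForm_self_nonneg _ _ _)
  have hC := h.C_pos
  calc √(sasakiForm g θ ξ ξ) = C * Real.exp (-(t * mu)) *
        (C⁻¹ * Real.exp (t * mu) * √(sasakiForm g θ ξ ξ)) := by
        rw [Real.exp_neg]; field_simp
    _ ≤ _ := mul_le_mul_of_nonneg_left h1 (by positivity)

lemma le_growth_unstable [T2Space M] (h : IsHyperbolicSplitting g φ Es Ec Eu C lam mu)
    (hφ : IsGeodesicFlow g φ) (hθ : θ ∈ unitBundle g) (hξ : contactForm g θ ξ = 0)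
    (hE : quotCoord g θ ξ ∈ Eu θ) {t : ℝ} (ht : 0 ≤ t) :
    sasakiForm g θ ξ ξ ≤ (C * Real.exp (t * lam)) ^ 2 * growth g φ θ t ξ := by
  have hm : toQuot g (φ t θ) (flowDeriv φ t θ ξ) ∈ Eu (φ t θ) := by
    rw [← h.inv_u t θ hθ]
    exact ⟨_, ⟨ξ, hE, rfl⟩, rfl⟩
  have h1 : totalQuotNorm g (tangentMap I.tangent I.tangent (φ (-t))
      (tangentMap I.tangent I.tangent (φ t) ⟨θ, ξ⟩)) ≤ C * Real.exp (t * lam) *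
      totalQuotNorm g (tangentMap I.tangent I.tangent (φ t) ⟨θ, ξ⟩) :=
    h.contract_u t ht (φ t θ) (map_mem_unitBundle hφ hθ t) _ hm
  have h2 : totalQuotNorm g ⟨θ, ξ⟩ = √(sasakiForm g θ ξ ξ) := quotNorm_quotCoord g θ hξ
  have h3 : totalQuotNorm g (tangentMap I.tangent I.tangent (φ t) ⟨θ, ξ⟩) = √(growth g φ θ t ξ) :=
    quotNorm_flowDeriv hφ hξ (normSqDeriv_eq_zero g ((h.le_unitQuot hθ).2.2 hE)) t
  have h4 := h2.symm.trans_le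
    ((congrArg (totalQuotNorm g) (hφ.tangentMap_neg_tangentMap t θ ξ)).symm.trans_le h1)
  rw [h3] at h4
  exact sqrt_le_mul_sqrt (growth_nonneg _ _ _ _ _) h4 (sasakiForm_self_nonneg _ _ _)

/-- The stable bundle consists of the vectors which are contracted with rate `lam`. -/
lemma mem_stable [T2Space M] (h : IsHyperbolicSplitting g φ Es Ec Eu C lam mu)
    (hφ : IsGeodesicFlow g φ) (hθ : θ ∈ unitBundle g) (hξ : contactForm g θ ξ = 0)
    (hξ' : normSqDeriv g θ ξ = 0) {K : ℝ}
    (hK : ∀ t : ℝ, 0 ≤ t → growth g φ θ t ξ ≤ K * Real.exp (t * lam) ^ 2) :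
    quotCoord g θ ξ ∈ Es θ := by
  obtain ⟨hs, hc, hu⟩ := h.le_unitQuot hθ
  have hq : quotCoord g θ ξ ∈ unitQuot g θ := ⟨ξ, hξ', rfl⟩
  rw [← h.sup_eq θ hθ] at hq
  obtain ⟨qsc, hsc, qu, hqu, hq⟩ := Submodule.mem_sup.1 hq
  obtain ⟨qs, hqs, qc, hqc, rfl⟩ := Submodule.mem_sup.1 hsc
  obtain ⟨s, rfl, s1, -⟩ := exists_lift g hθ (hs hqs)
  obtain ⟨c, rfl, c1, -⟩ := exists_lift g hθ (hc hqc)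
  obtain ⟨u, rfl, u1, -⟩ := exists_lift g hθ (hu hqu)
  have hsum : s + c + u = ξ := quotCoord_injOn g hθ
    (by rw [contactForm_add, contactForm_add, s1, c1, u1]; ring) hξ hq
  obtain ⟨K', hK'⟩ : ∃ K', ∀ t : ℝ, 0 ≤ t →
      growth g φ θ t (c + u) ≤ K' * Real.exp (t * lam) ^ 2 := by
    refine ⟨2 * K + 2 * C ^ 2 * sasakiForm g θ s s, fun t ht => ?_⟩
    have h1 := growth_sub_le g φ θ t ξ s
    have h2 := h.growth_stable_le hφ hθ s1 hqs ht
    rw [← hsum, show s + c + u - s = c + u by abel, hsum] at h1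
    have h3 := hK t ht
    rw [mul_pow] at h2
    linarith
  have hlm := h.lam_lt
  have hmu := h.mu_neg
  have hle : ∀ t : ℝ, 0 ≤ t → Real.exp (t * lam) ≤ Real.exp (t * (lam - mu)) := fun t ht =>
    Real.exp_le_exp.2 (mul_le_mul_of_nonneg_left (by linarith) ht)
  have hmul : ∀ t : ℝ, Real.exp (t * lam) * Real.exp (-(t * mu)) = Real.exp (t * (lam - mu)) :=
    fun t => by rw [← Real.exp_add]; ring_nf
  have hK0 : 0 ≤ K' := by
    have := (growth_nonneg g φ θ 0 (c + u)).trans (hK' 0 le_rfl)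
    simpa using this
  have hu0 : u = 0 := by
    refine eq_zero_of_sasakiForm_self_le g θ (nonpos_of_le_exp (δ := lam - mu)
      (K := C ^ 2 * (2 * K' + 2 * (C ^ 2 * sasakiForm g θ c c))) (by linarith) fun t ht => ?_)
    have h1 := h.le_growth_unstable hφ hθ u1 hqu ht
    have h2 := growth_sub_le g φ θ t (c + u) c
    rw [add_sub_cancel_left] at h2
    have h3 := h.growth_center_le hφ hθ c1 hqc ht
    have h4 := hK' t ht
    set x := Real.exp (t * lam)
    set y := Real.exp (-(t * mu))
    set r := Real.exp (t * (lam - mu))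
    have hx0 : 0 < x := Real.exp_pos _
    have hx1 : x ≤ 1 := Real.exp_le_one_iff.2 (mul_nonpos_of_nonneg_of_nonpos ht (by linarith))
    have hxr : x ^ 2 * x ^ 2 ≤ r ^ 2 := by
      have := hle t ht
      calc x ^ 2 * x ^ 2 ≤ r ^ 2 * 1 := by gcongr; exact pow_le_one₀ hx0.le hx1
        _ = r ^ 2 := mul_one _
    calc sasakiForm g θ u u ≤ (C * x) ^ 2 * growth g φ θ t u := h1
      _ ≤ (C * x) ^ 2 * (2 * (K' * x ^ 2) + 2 * ((C * y) ^ 2 * sasakiForm g θ c c)) := by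
        gcongr; linarith
      _ = C ^ 2 * (2 * K' * (x ^ 2 * x ^ 2) +
          2 * (C ^ 2 * sasakiForm g θ c c) * (x * y) ^ 2) := by ring
      _ ≤ C ^ 2 * (2 * K' * r ^ 2 + 2 * (C ^ 2 * sasakiForm g θ c c) * r ^ 2) := by
        rw [hmul t]; gcongr
      _ = _ := by ring
  have hc0 : c = 0 := by
    refine eq_zero_of_sasakiForm_self_le g θ (nonpos_of_le_exp (δ := lam - mu)
      (K := C ^ 2 * K') (by linarith) fun t ht => ?_)
    have h1 := h.le_growth_center hφ hθ c1 hqc ht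
    have h2 := hK' t ht
    rw [hu0, add_zero] at h2
    calc sasakiForm g θ c c ≤ (C * Real.exp (-(t * mu))) ^ 2 * growth g φ θ t c := h1
      _ ≤ (C * Real.exp (-(t * mu))) ^ 2 * (K' * Real.exp (t * lam) ^ 2) := by gcongr
      _ = C ^ 2 * K' * (Real.exp (t * lam) * Real.exp (-(t * mu))) ^ 2 := by ring
      _ = _ := by rw [hmul t]
  rw [hu0, hc0, add_zero, add_zero] at hsum
  exact hsum ▸ hqs

end IsHyperbolicSplitting

end Sasaki

section Semiconjugation

variable {E : Type*} [NormedAddCommGroup E] [NormedSpace ℝ E] [FiniteDimensional ℝ E]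
  {H : Type*} [TopologicalSpace H] {I : ModelWithCorners ℝ E H} [I.Boundaryless]
  {M : Type*} [TopologicalSpace M] [ChartedSpace H M] [IsManifold I ∞ M]
  {E' : Type*} [NormedAddCommGroup E'] [NormedSpace ℝ E'] [FiniteDimensional ℝ E']
  {H' : Type*} [TopologicalSpace H'] {J : ModelWithCorners ℝ E' H'} [J.Boundaryless]
  {N : Type*} [TopologicalSpace N] [ChartedSpace H' N] [IsManifold J ∞ N] [T2Space N]
  {g : Metric I M} {φ : ℝ → TangentBundle I M → TangentBundle I M}

lemma IsGeodesicFlow.semiconj (hφ : IsGeodesicFlow g φ)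
    {q : TangentBundle I M → TangentBundle J N} {σ : TangentBundle J N → TangentBundle I M}
    {Y : ∀ η : TangentBundle J N, TangentSpace J.tangent η}
    (hq : ContMDiff I.tangent J.tangent ∞ q) (hσ : ContMDiff J.tangent I.tangent ∞ σ)
    (hqσ : ∀ η, q (σ η) = η)
    (hY : ∀ θ, mfderiv I.tangent J.tangent q θ (geodesicField g θ) = Y (q θ))
    {θ θ' : TangentBundle I M} (h : q θ = q θ') (t : ℝ) : q (φ t θ) = q (φ t θ') := by
  have hYs : ContMDiff J.tangent J.tangent.tangent ∞ (fun η : TangentBundle J N =>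
      (⟨η, Y η⟩ : TangentBundle J.tangent (TangentBundle J N))) := by
    have h1 := (hq.contMDiff_tangentMap (m := ∞) le_rfl).comp
      (hφ.contMDiff_geodesicField.comp hσ)
    convert h1 using 1
    funext η
    have h2 : (⟨η, Y η⟩ : TangentBundle J.tangent (TangentBundle J N)) =
        ⟨q (σ η), Y (q (σ η))⟩ := by rw [hqσ]
    rw [h2, ← hY]
    rfl
  have hc (θ : TangentBundle I M) : IsMIntegralCurve (I := J.tangent) (fun t => q (φ t θ)) Y := by
    intro t
    have h1 := ((hq (φ t θ)).mdifferentiableAt (by simp)).hasMFDerivAt.comp t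
      (hφ.isMIntegralCurve θ t)
    refine h1.congr_mfderiv (ContinuousLinearMap.ext_ring ?_)
    change mfderiv I.tangent J.tangent q (φ t θ) ((1 : ℝ) • geodesicField g (φ t θ)) =
      (1 : ℝ) • Y (q (φ t θ))
    rw [one_smul, one_smul, hY]
  have := isMIntegralCurve_Ioo_eq_of_contMDiff_boundaryless (t₀ := 0)
    (hYs.of_le (n := ∞) (m := 1) ENat.LEInfty.out) (hc θ) (hc θ')
    (by simp only [hφ.map_zero, h])
  exact congrFun this t

lemma tangentMap_semiconj {f : TangentBundle I M → TangentBundle I M}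
    {q : TangentBundle I M → TangentBundle J N} {σ : TangentBundle J N → TangentBundle I M}
    (hf : ContMDiff I.tangent I.tangent ∞ f)
    (hq : ContMDiff I.tangent J.tangent ∞ q) (hσ : ContMDiff J.tangent I.tangent ∞ σ)
    (hqσ : ∀ η, q (σ η) = η) (hfq : ∀ θ θ', q θ = q θ' → q (f θ) = q (f θ'))
    {ζ ζ' : TangentBundle I.tangent (TangentBundle I M)}
    (h : tangentMap I.tangent J.tangent q ζ = tangentMap I.tangent J.tangent q ζ') :
    tangentMap I.tangent J.tangent q (tangentMap I.tangent I.tangent f ζ) =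
      tangentMap I.tangent J.tangent q (tangentMap I.tangent I.tangent f ζ') := by
  have e : q ∘ f = (q ∘ f ∘ σ) ∘ q := funext fun θ => hfq _ _ (hqσ (q θ)).symm
  have key (ζ : TangentBundle I.tangent (TangentBundle I M)) :
      tangentMap I.tangent J.tangent q (tangentMap I.tangent I.tangent f ζ) =
      tangentMap J.tangent J.tangent (q ∘ f ∘ σ) (tangentMap I.tangent J.tangent q ζ) := by
    rw [← tangentMap_comp_at ζ ((hq _).mdifferentiableAt (by simp))
      ((hf _).mdifferentiableAt (by simp)), e,
      tangentMap_comp_at ζ (((hq.comp (hf.comp hσ)) _).mdifferentiableAt (by simp))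
      ((hq _).mdifferentiableAt (by simp))]
  rw [key, key, h]

end Semiconjugation

lemma hasDerivAt_line {F : Type*} [NormedAddCommGroup F] [NormedSpace ℝ F] (z v : F) :
    HasDerivAt (fun t : ℝ => z + t • v) v 0 := by
  simpa using (((hasDerivAt_id (0 : ℝ)).smul_const v).const_add z :)

section Product

variable {E₁ : Type*} [NormedAddCommGroup E₁] [NormedSpace ℝ E₁]
  {H₁ : Type*} [TopologicalSpace H₁] {I₁ : ModelWithCorners ℝ E₁ H₁} [I₁.Boundaryless]
  {M₁ : Type*} [TopologicalSpace M₁] [ChartedSpace H₁ M₁] [IsManifold I₁ ∞ M₁]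
  {E₂ : Type*} [NormedAddCommGroup E₂] [NormedSpace ℝ E₂]
  {H₂ : Type*} [TopologicalSpace H₂] {I₂ : ModelWithCorners ℝ E₂ H₂} [I₂.Boundaryless]
  {M₂ : Type*} [TopologicalSpace M₂] [ChartedSpace H₂ M₂] [IsManifold I₂ ∞ M₂]

lemma tangentCoordChange_prod {p q r : M₁ × M₂}
    (h : r ∈ (extChartAt (I₁.prod I₂) p).source ∩ (extChartAt (I₁.prod I₂) q).source)
    (v : E₁ × E₂) :
    tangentCoordChange (I₁.prod I₂) p q r v =
      (tangentCoordChange I₁ p.1 q.1 r.1 v.1, tangentCoordChange I₂ p.2 q.2 r.2 v.2) := by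
  have h0 := hasFDerivAt_tangentCoordChange h
  rw [extChartAt_prod, extChartAt_prod] at h
  have h1 := hasFDerivAt_tangentCoordChange (I := I₁) (x := p.1) (y := q.1) (z := r.1)
    ⟨h.1.1, h.2.1⟩
  have h2 := hasFDerivAt_tangentCoordChange (I := I₂) (x := p.2) (y := q.2) (z := r.2)
    ⟨h.1.2, h.2.2⟩
  have h3 : HasFDerivAt (extChartAt (I₁.prod I₂) q ∘ (extChartAt (I₁.prod I₂) p).symm) _
    (extChartAt (I₁.prod I₂) p r) := HasFDerivAt.prodMap (extChartAt (I₁.prod I₂) p r) h1 h2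
  rw [h0.unique h3]
  rfl

/-- The projection `T(M₁ × M₂) → TM₁`. -/
def tangentFst (θ : TangentBundle (I₁.prod I₂) (M₁ × M₂)) : TangentBundle I₁ M₁ :=
  ⟨θ.1.1, θ.2.1⟩

/-- The projection `T(M₁ × M₂) → TM₂`. -/
def tangentSnd (θ : TangentBundle (I₁.prod I₂) (M₁ × M₂)) : TangentBundle I₂ M₂ :=
  ⟨θ.1.2, θ.2.2⟩

lemma contMDiff_tangentFst : ContMDiff (I₁.prod I₂).tangent I₁.tangent ∞
    (tangentFst : TangentBundle (I₁.prod I₂) (M₁ × M₂) → TangentBundle I₁ M₁) := by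
  have T : ContMDiff (I₁.prod I₂).tangent I₁.tangent ∞
      (tangentMap (I₁.prod I₂) I₁ (Prod.fst : M₁ × M₂ → M₁)) :=
    contMDiff_fst.contMDiff_tangentMap (n := ∞) le_rfl
  rwa [show tangentMap (I₁.prod I₂) I₁ (Prod.fst : M₁ × M₂ → M₁) = tangentFst from
    funext fun q => tangentMap_prodFst] at T

lemma contMDiff_tangentSnd : ContMDiff (I₁.prod I₂).tangent I₂.tangent ∞
    (tangentSnd : TangentBundle (I₁.prod I₂) (M₁ × M₂) → TangentBundle I₂ M₂) := by
  have T : ContMDiff (I₁.prod I₂).tangent I₂.tangent ∞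
      (tangentMap (I₁.prod I₂) I₂ (Prod.snd : M₁ × M₂ → M₂)) :=
    contMDiff_snd.contMDiff_tangentMap (n := ∞) le_rfl
  rwa [show tangentMap (I₁.prod I₂) I₂ (Prod.snd : M₁ × M₂ → M₂) = tangentSnd from
    funext fun q => tangentMap_prodSnd] at T

lemma tangentMap_tangentFst (θ : TangentBundle (I₁.prod I₂) (M₁ × M₂))
    (ξ : (E₁ × E₂) × (E₁ × E₂)) :
    tangentMap (I₁.prod I₂).tangent I₁.tangent tangentFst
      (⟨θ, ξ⟩ : TangentBundle (I₁.prod I₂).tangent (TangentBundle (I₁.prod I₂) (M₁ × M₂))) =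
      ⟨tangentFst θ, ((ξ.1.1, ξ.2.1) : E₁ × E₁)⟩ := by
  have h := hasMFDerivAt_of_chart (I := (I₁.prod I₂).tangent) (J := I₁.tangent)
    (f := (tangentFst : TangentBundle (I₁.prod I₂) (M₁ × M₂) → TangentBundle I₁ M₁)) (x := θ)
    (fun z : (E₁ × E₂) × (E₁ × E₂) => (z.1.1, z.2.1)) contMDiff_tangentFst.continuous.continuousAt
    ((((hasFDerivAt_id (𝕜 := ℝ) (extChartAt (I₁.prod I₂).tangent θ θ)).fst).fst).prodMk
      (((hasFDerivAt_id (𝕜 := ℝ) (extChartAt (I₁.prod I₂).tangent θ θ)).snd).fst)) (by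
      filter_upwards [eventually_mem_source θ] with η hη
      rw [extChartAt_tangent_eq, extChartAt_tangent_eq,
        tangentCoordChange_prod ⟨mem_extChartAt_source _, hη⟩]
      rfl)
  simp only [tangentMap]
  rw [h.mfderiv]
  rfl

lemma tangentMap_tangentSnd (θ : TangentBundle (I₁.prod I₂) (M₁ × M₂))
    (ξ : (E₁ × E₂) × (E₁ × E₂)) :
    tangentMap (I₁.prod I₂).tangent I₂.tangent tangentSnd
      (⟨θ, ξ⟩ : TangentBundle (I₁.prod I₂).tangent (TangentBundle (I₁.prod I₂) (M₁ × M₂))) =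
      ⟨tangentSnd θ, ((ξ.1.2, ξ.2.2) : E₂ × E₂)⟩ := by
  have h := hasMFDerivAt_of_chart (I := (I₁.prod I₂).tangent) (J := I₂.tangent)
    (f := (tangentSnd : TangentBundle (I₁.prod I₂) (M₁ × M₂) → TangentBundle I₂ M₂)) (x := θ)
    (fun z : (E₁ × E₂) × (E₁ × E₂) => (z.1.2, z.2.2)) contMDiff_tangentSnd.continuous.continuousAt
    ((((hasFDerivAt_id (𝕜 := ℝ) (extChartAt (I₁.prod I₂).tangent θ θ)).fst).snd).prodMk
      (((hasFDerivAt_id (𝕜 := ℝ) (extChartAt (I₁.prod I₂).tangent θ θ)).snd).snd)) (by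
      filter_upwards [eventually_mem_source θ] with η hη
      rw [extChartAt_tangent_eq, extChartAt_tangent_eq,
        tangentCoordChange_prod ⟨mem_extChartAt_source _, hη⟩]
      rfl)
  simp only [tangentMap]
  rw [h.mfderiv]
  rfl

variable [FiniteDimensional ℝ E₁] [FiniteDimensional ℝ E₂]

lemma metricForm_prod (g₁ : Metric I₁ M₁) (g₂ : Metric I₂ M₂) (p : M₁ × M₂) (a b : E₁ × E₂) :
    metricForm (g₁.prod g₂) p a b = metricForm g₁ p.1 a.1 b.1 + metricForm g₂ p.2 a.2 b.2 := rfl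

lemma coordMetric_prod (g₁ : Metric I₁ M₁) (g₂ : Metric I₂ M₂) (p : M₁ × M₂) {z : E₁ × E₂}
    (hz : z ∈ (extChartAt (I₁.prod I₂) p).target) (a b : E₁ × E₂) :
    coordMetric (g₁.prod g₂) p z a b =
      coordMetric g₁ p.1 z.1 a.1 b.1 + coordMetric g₂ p.2 z.2 a.2 b.2 := by
  have hz' := hz
  rw [extChartAt_prod] at hz'
  rw [coordMetric_apply _ _ hz, coordMetric_apply _ _ hz'.1, coordMetric_apply _ _ hz'.2,
    tangentCoordChange_prod ⟨(extChartAt (I₁.prod I₂) p).map_target hz, mem_extChartAt_source _⟩,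
    tangentCoordChange_prod ⟨(extChartAt (I₁.prod I₂) p).map_target hz, mem_extChartAt_source _⟩]
  rfl

lemma coordMetricDeriv_prod (g₁ : Metric I₁ M₁) (g₂ : Metric I₂ M₂) (p : M₁ × M₂)
    (c a b : E₁ × E₂) :
    coordMetricDeriv (g₁.prod g₂) p c a b =
      coordMetricDeriv g₁ p.1 c.1 a.1 b.1 + coordMetricDeriv g₂ p.2 c.2 a.2 b.2 := by
  have h := hasDerivAt_coordMetric (g₁.prod g₂) p (hasDerivAt_line (extChartAt (I₁.prod I₂) p p) c)
    (hasDerivAt_const 0 a) (hasDerivAt_const 0 b) (by simp)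
  have h1 := hasDerivAt_coordMetric g₁ p.1 (hasDerivAt_line (extChartAt I₁ p.1 p.1) c.1)
    (hasDerivAt_const 0 a.1) (hasDerivAt_const 0 b.1) (by simp)
  have h2 := hasDerivAt_coordMetric g₂ p.2 (hasDerivAt_line (extChartAt I₂ p.2 p.2) c.2)
    (hasDerivAt_const 0 a.2) (hasDerivAt_const 0 b.2) (by simp)
  have h3 := h.unique ((h1.add h2).congr_of_eventuallyEq ?_)
  · simpa using h3
  · have ht : Filter.Tendsto (fun t : ℝ => extChartAt (I₁.prod I₂) p p + t • c) (𝓝 0)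
        (𝓝 (extChartAt (I₁.prod I₂) p p)) := by
      simpa using (hasDerivAt_line (extChartAt (I₁.prod I₂) p p) c).continuousAt.tendsto
    filter_upwards [ht.eventually (extChartAt_target_mem_nhds (I := I₁.prod I₂) p)] with t ht
    rw [coordMetric_prod g₁ g₂ p ht]
    simp

lemma christoffel_prod (g₁ : Metric I₁ M₁) (g₂ : Metric I₂ M₂) (p : M₁ × M₂) (a b : E₁ × E₂) :
    christoffel (g₁.prod g₂) p a b =
      (christoffel g₁ p.1 a.1 b.1, christoffel g₂ p.2 a.2 b.2) := by
  refine sub_eq_zero.1 (eq_zero_of_metricForm_eq_zero (g₁.prod g₂) p ?_)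
  have h (c : E₁ × E₂) : metricForm (g₁.prod g₂) p (christoffel (g₁.prod g₂) p a b -
      (christoffel g₁ p.1 a.1 b.1, christoffel g₂ p.2 a.2 b.2)) c = 0 := by
    rw [map_sub, LinearMap.sub_apply, inner_christoffel, metricForm_prod, inner_christoffel,
      inner_christoffel, coordMetricDeriv_prod, coordMetricDeriv_prod, coordMetricDeriv_prod]
    ring
  exact h _

lemma tangentMap_tangentFst_geodesicField (g₁ : Metric I₁ M₁) (g₂ : Metric I₂ M₂)
    (θ : TangentBundle (I₁.prod I₂) (M₁ × M₂)) :
    mfderiv (I₁.prod I₂).tangent I₁.tangent tangentFst θ (geodesicField (g₁.prod g₂) θ) =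
      geodesicField g₁ (tangentFst θ) := by
  have h := congrArg (fun ζ : TangentBundle I₁.tangent (TangentBundle I₁ M₁) => vec ζ)
    (tangentMap_tangentFst θ (geodesicCoord (g₁.prod g₂) θ))
  refine Eq.trans (b := _) h ?_
  change ((geodesicCoord (g₁.prod g₂) θ).1.1, (geodesicCoord (g₁.prod g₂) θ).2.1) =
    geodesicCoord g₁ (tangentFst θ)
  simp only [geodesicCoord, christoffel_prod]
  rfl

lemma tangentMap_tangentSnd_geodesicField (g₁ : Metric I₁ M₁) (g₂ : Metric I₂ M₂)
    (θ : TangentBundle (I₁.prod I₂) (M₁ × M₂)) :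
    mfderiv (I₁.prod I₂).tangent I₂.tangent tangentSnd θ (geodesicField (g₁.prod g₂) θ) =
      geodesicField g₂ (tangentSnd θ) := by
  have h := congrArg (fun ζ : TangentBundle I₂.tangent (TangentBundle I₂ M₂) => vec ζ)
    (tangentMap_tangentSnd θ (geodesicCoord (g₁.prod g₂) θ))
  refine Eq.trans (b := _) h ?_
  change ((geodesicCoord (g₁.prod g₂) θ).1.2, (geodesicCoord (g₁.prod g₂) θ).2.2) =
    geodesicCoord g₂ (tangentSnd θ)
  simp only [geodesicCoord, christoffel_prod]
  rfl

end Product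

section Scaling

variable {E : Type*} [NormedAddCommGroup E] [NormedSpace ℝ E]
  {H : Type*} [TopologicalSpace H] {I : ModelWithCorners ℝ E H} [I.Boundaryless]
  {M : Type*} [TopologicalSpace M] [ChartedSpace H M] [IsManifold I ∞ M]

/-- Multiplication by `s` in the fibers of the tangent bundle. -/
def scale (s : ℝ) (θ : TangentBundle I M) : TangentBundle I M := ⟨θ.1, s • θ.2⟩

lemma continuous_scale (s : ℝ) : Continuous (scale s : TangentBundle I M → TangentBundle I M) := by
  rw [continuous_iff_continuousAt]
  intro θ
  rw [FiberBundle.continuousAt_totalSpace]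
  refine ⟨(FiberBundle.continuous_proj E (TangentSpace I)).continuousAt, ?_⟩
  have h1 : ContinuousAt (fun η : TangentBundle I M =>
      s • (trivializationAt E (TangentSpace I : M → Type _) θ.1 η).2) θ :=
    (((FiberBundle.continuousAt_totalSpace E (f := (id : TangentBundle I M → _))).1
      continuousAt_id).2).const_smul s
  refine h1.congr ?_
  filter_upwards [eventually_mem_source θ] with η hη
  rw [TangentBundle.trivializationAt_apply, TangentBundle.trivializationAt_apply]
  exact (map_smul (tangentCoordChange I η.1 θ.1 η.1) s (vec η)).symm

/-- The differential of `scale` in coordinates. -/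
def scaleCoord (s : ℝ) : E × E →L[ℝ] E × E :=
  (ContinuousLinearMap.fst ℝ E E).prod (s • ContinuousLinearMap.snd ℝ E E)

lemma scaleCoord_apply (s : ℝ) (ξ : E × E) : scaleCoord s ξ = (ξ.1, s • ξ.2) := rfl

lemma hasMFDerivAt_scale (s : ℝ) (θ : TangentBundle I M) :
    letI L : TangentSpace I.tangent θ →L[ℝ] TangentSpace I.tangent (scale s θ) :=
      (scaleCoord s : E × E →L[ℝ] E × E)
    HasMFDerivAt I.tangent I.tangent (scale s) θ L := by
  refine hasMFDerivAt_of_chart (scaleCoord s) (continuous_scale s).continuousAt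
    (ContinuousLinearMap.hasFDerivAt _) ?_
  filter_upwards with η
  rw [extChartAt_tangent_eq, extChartAt_tangent_eq]
  exact Prod.ext rfl (map_smul (tangentCoordChange I η.1 θ.1 η.1) s (vec η))

lemma scale_zero_scale (s : ℝ) (θ : TangentBundle I M) : scale s (scale 0 θ) = scale 0 θ :=
  congrArg (fun v : E => (⟨θ.1, v⟩ : TangentBundle I M))
    (show s • (0 : ℝ) • vec θ = (0 : ℝ) • vec θ by rw [zero_smul, smul_zero])

variable [FiniteDimensional ℝ E] [T2Space M]
  {g : Metric I M} {φ : ℝ → TangentBundle I M → TangentBundle I M}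

lemma IsGeodesicFlow.map_scale (hφ : IsGeodesicFlow g φ) (s t : ℝ) (θ : TangentBundle I M) :
    φ t (scale s θ) = scale s (φ (t * s) θ) := by
  have h1 := (hφ.isMIntegralCurve θ).comp_mul s
  have h2 : IsMIntegralCurve (I := I.tangent) (fun t => scale s (φ (t * s) θ))
      (geodesicField g) := by
    intro t
    refine ((hasMFDerivAt_scale s (φ (t * s) θ)).comp t (h1 t)).congr_mfderiv
      (ContinuousLinearMap.ext_ring ?_)
    change scaleCoord s ((1 : ℝ) • s • geodesicCoord g (φ (t * s) θ)) =
      (1 : ℝ) • geodesicCoord g (scale s (φ (t * s) θ))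
    rw [one_smul, one_smul, scaleCoord_apply, geodesicCoord, geodesicCoord,
      show vec (scale s (φ (t * s) θ)) = s • vec (φ (t * s) θ) from rfl,
      christoffel_smul_smul]
    simp only [Prod.smul_fst, Prod.smul_snd, smul_neg, smul_smul]
    rfl
  have h3 := hφ.eq_of_isMIntegralCurve h2 t
  rw [h3]
  simp only [zero_mul, hφ.map_zero]

lemma IsGeodesicFlow.flowCoord_scale (hφ : IsGeodesicFlow g φ) (s t : ℝ) (θ : TangentBundle I M)
    (ξ : E × E) :
    flowCoord φ t (scale s θ) (scaleCoord s ξ) = scaleCoord s (flowCoord φ (t * s) θ ξ) := by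
  have h1 := (hφ.mdifferentiableAt t (scale s θ)).hasMFDerivAt.comp θ (hasMFDerivAt_scale s θ)
  have h2 := (hasMFDerivAt_scale s (φ (t * s) θ)).comp θ
    (hφ.mdifferentiableAt (t * s) θ).hasMFDerivAt
  have h3 : φ t ∘ scale s = scale s ∘ φ (t * s) := funext fun η => hφ.map_scale s t η
  have h4 : mfderiv I.tangent I.tangent (φ t ∘ scale s) θ =
      mfderiv I.tangent I.tangent (scale s ∘ φ (t * s)) θ := by rw [h3]
  rw [h1.mfderiv, h2.mfderiv] at h4
  exact congrArg (fun L : E × E →L[ℝ] E × E => L ξ) h4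

lemma IsGeodesicFlow.flowCoord_zero (hφ : IsGeodesicFlow g φ) (θ : TangentBundle I M)
    (ξ : E × E) : flowCoord φ 0 θ ξ = ξ := by
  have h0 : tangentMap I.tangent I.tangent (φ 0) ⟨θ, ξ⟩ = ⟨θ, ξ⟩ := by
    rw [show φ 0 = id from funext hφ.map_zero, tangentMap_id]
    rfl
  exact congrArg (fun ζ : TangentBundle I.tangent (TangentBundle I M) => vec ζ) h0

lemma IsGeodesicFlow.flowCoord_neg (hφ : IsGeodesicFlow g φ) (t : ℝ) (θ : TangentBundle I M)
    (ξ : E × E) : flowCoord φ (-t) (φ t θ) (flowCoord φ t θ ξ) = ξ :=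
  congrArg (fun ζ : TangentBundle I.tangent (TangentBundle I M) => vec ζ)
    (hφ.tangentMap_neg_tangentMap t θ ξ)

lemma IsGeodesicFlow.map_scale_zero (hφ : IsGeodesicFlow g φ) (t : ℝ) (θ : TangentBundle I M) :
    φ t (scale 0 θ) = scale 0 θ := by
  rw [hφ.map_scale, mul_zero, hφ.map_zero]

/-- At a zero vector, no nonzero vector is exponentially contracted. -/
lemma IsGeodesicFlow.eq_zero_of_growth_le (hφ : IsGeodesicFlow g φ) (θ : TangentBundle I M)
    {ξ : E × E} {K δ : ℝ} (hδ : δ < 0)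
    (hK : ∀ t : ℝ, 0 ≤ t → growth g φ (scale 0 θ) t ξ ≤ K * Real.exp (t * δ) ^ 2) : ξ = 0 := by
  set A : ℝ → E × E →L[ℝ] E × E := fun t => flowCoord φ t (scale 0 θ) with hA
  have hv : vec (scale 0 θ) = 0 := zero_smul ℝ (vec θ)
  have hAs (s t : ℝ) (η : E × E) : A t (scaleCoord s η) = scaleCoord s (A (t * s) η) := by
    have := hφ.flowCoord_scale s t (scale 0 θ) η
    rwa [scale_zero_scale] at this
  have hh (t : ℝ) (h : E) : A t (h, 0) = (h, 0) := by
    have := hAs 0 t (h, 0)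
    simp only [scaleCoord_apply, smul_zero, zero_smul, mul_zero] at this
    rw [this, hA]
    simp only [hφ.flowCoord_zero]
  have hg (t : ℝ) : growth g φ (scale 0 θ) t ξ =
      metricForm g θ.1 (A t ξ).1 (A t ξ).1 + metricForm g θ.1 (A t ξ).2 (A t ξ).2 := by
    unfold growth
    rw [hφ.map_scale_zero, sasakiForm_apply, hv, christoffel_zero_right, add_zero]
    rfl
  have hw (t : ℝ) (ht : t ≠ 0) : (A t ξ).2 = (A 1 (0, ξ.2)).2 := by
    have h1 := hAs t 1 ξ
    rw [scaleCoord_apply, one_mul, scaleCoord_apply,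
      show (ξ.1, t • ξ.2) = (ξ.1, 0) + t • ((0 : E), ξ.2) by simp, _root_.map_add, map_smul, hh] at h1
    have h2 := congrArg Prod.snd h1
    simp only [Prod.snd_add, Prod.smul_snd, zero_add] at h2
    exact (smul_right_injective E ht h2).symm
  have hw1 : (A 1 (0, ξ.2)).2 = 0 := by
    refine eq_zero_of_metricForm_eq_zero g θ.1 (le_antisymm ?_ (metricForm_nonneg _ _ _))
    refine nonpos_of_le_exp (K := K * Real.exp δ ^ 2) hδ fun t ht => ?_
    have h1 := hK (t + 1) (by linarith)
    rw [hg, hw _ (by linarith)] at h1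
    rw [add_mul, one_mul, Real.exp_add] at h1
    have h2 := metricForm_nonneg g θ.1 (A (t + 1) ξ).1
    calc _ ≤ K * (Real.exp (t * δ) * Real.exp δ) ^ 2 := by linarith
      _ = _ := by ring
  have h3 : A 1 ξ = A 1 ((A 1 ξ).1, 0) := by
    rw [hh]
    exact Prod.ext rfl ((hw 1 one_ne_zero).trans hw1)
  have h4 : ξ = ((A 1 ξ).1, 0) := (hφ.flowCoord_neg 1 (scale 0 θ) ξ).symm.trans
    ((congrArg (flowCoord φ (-1) (φ 1 (scale 0 θ))) h3).trans (hφ.flowCoord_neg 1 (scale 0 θ) _))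
  have h5 : ξ = (ξ.1, 0) := by
    rw [h4]
  have h6 : ξ.1 = 0 := by
    refine eq_zero_of_metricForm_eq_zero g θ.1 (le_antisymm ?_ (metricForm_nonneg _ _ _))
    refine nonpos_of_le_exp hδ fun t ht => (le_trans (le_of_eq ?_) (hK t ht))
    rw [hg, h5, hh]
    simp
  rw [h5, h6]
  rfl

end Scaling

section ProductFlow

variable {E₁ : Type*} [NormedAddCommGroup E₁] [NormedSpace ℝ E₁] [FiniteDimensional ℝ E₁]
  {H₁ : Type*} [TopologicalSpace H₁] {I₁ : ModelWithCorners ℝ E₁ H₁} [I₁.Boundaryless]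
  {M₁ : Type*} [TopologicalSpace M₁] [ChartedSpace H₁ M₁] [IsManifold I₁ ∞ M₁] [T2Space M₁]
  {E₂ : Type*} [NormedAddCommGroup E₂] [NormedSpace ℝ E₂] [FiniteDimensional ℝ E₂]
  {H₂ : Type*} [TopologicalSpace H₂] {I₂ : ModelWithCorners ℝ E₂ H₂} [I₂.Boundaryless]
  {M₂ : Type*} [TopologicalSpace M₂] [ChartedSpace H₂ M₂] [IsManifold I₂ ∞ M₂] [T2Space M₂]
  {g₁ : Metric I₁ M₁} {g₂ : Metric I₂ M₂}
  {φ : ℝ → TangentBundle (I₁.prod I₂) (M₁ × M₂) → TangentBundle (I₁.prod I₂) (M₁ × M₂)}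

/-- The inclusion `TM₁ → T(M₁ × M₂)` along a zero vector of `TM₂`. -/
def inclFst (y : M₂) (θ : TangentBundle I₁ M₁) : TangentBundle (I₁.prod I₂) (M₁ × M₂) :=
  ⟨(θ.1, y), ((vec θ, 0) : E₁ × E₂)⟩

/-- The inclusion `TM₂ → T(M₁ × M₂)` along a zero vector of `TM₁`. -/
def inclSnd (x : M₁) (θ : TangentBundle I₂ M₂) : TangentBundle (I₁.prod I₂) (M₁ × M₂) :=
  ⟨(x, θ.1), ((0, vec θ) : E₁ × E₂)⟩

lemma contMDiff_inclFst (y : M₂) : ContMDiff I₁.tangent (I₁.prod I₂).tangent ∞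
    (inclFst y : TangentBundle I₁ M₁ → TangentBundle (I₁.prod I₂) (M₁ × M₂)) :=
  (contMDiff_equivTangentBundleProd_symm (I := I₁) (M := M₁) (I' := I₂) (M' := M₂) (n := ∞)).comp
    (contMDiff_id.prodMk (contMDiff_const (c := (⟨y, (0 : E₂)⟩ : TangentBundle I₂ M₂))))

lemma contMDiff_inclSnd (x : M₁) : ContMDiff I₂.tangent (I₁.prod I₂).tangent ∞
    (inclSnd x : TangentBundle I₂ M₂ → TangentBundle (I₁.prod I₂) (M₁ × M₂)) :=
  (contMDiff_equivTangentBundleProd_symm (I := I₁) (M := M₁) (I' := I₂) (M' := M₂) (n := ∞)).comp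
    ((contMDiff_const (c := (⟨x, (0 : E₁)⟩ : TangentBundle I₁ M₁))).prodMk contMDiff_id)

lemma tangentFst_map (hφ : IsGeodesicFlow (g₁.prod g₂) φ)
    {θ θ' : TangentBundle (I₁.prod I₂) (M₁ × M₂)} (h : tangentFst θ = tangentFst θ') (t : ℝ) :
    tangentFst (φ t θ) = tangentFst (φ t θ') :=
  hφ.semiconj contMDiff_tangentFst (contMDiff_inclFst θ.1.2) (fun _ => rfl)
    (tangentMap_tangentFst_geodesicField g₁ g₂) h t

lemma tangentSnd_map (hφ : IsGeodesicFlow (g₁.prod g₂) φ)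
    {θ θ' : TangentBundle (I₁.prod I₂) (M₁ × M₂)} (h : tangentSnd θ = tangentSnd θ') (t : ℝ) :
    tangentSnd (φ t θ) = tangentSnd (φ t θ') :=
  hφ.semiconj contMDiff_tangentSnd (contMDiff_inclSnd θ.1.1) (fun _ => rfl)
    (tangentMap_tangentSnd_geodesicField g₁ g₂) h t

/-- The components along the first factor. -/
def fstCoord : (E₁ × E₂) × (E₁ × E₂) →L[ℝ] E₁ × E₁ :=
  (ContinuousLinearMap.fst ℝ E₁ E₂).prodMap (ContinuousLinearMap.fst ℝ E₁ E₂)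

/-- The components along the second factor. -/
def sndCoord : (E₁ × E₂) × (E₁ × E₂) →L[ℝ] E₂ × E₂ :=
  (ContinuousLinearMap.snd ℝ E₁ E₂).prodMap (ContinuousLinearMap.snd ℝ E₁ E₂)

lemma fstCoord_flowCoord (hφ : IsGeodesicFlow (g₁.prod g₂) φ)
    {θ θ' : TangentBundle (I₁.prod I₂) (M₁ × M₂)} (h : tangentFst θ = tangentFst θ') (t : ℝ)
    {ξ ξ' : (E₁ × E₂) × (E₁ × E₂)} (hξ : fstCoord ξ = fstCoord ξ') :
    fstCoord (flowCoord φ t θ ξ) = fstCoord (flowCoord φ t θ' ξ') := by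
  have h1 : tangentMap (I₁.prod I₂).tangent I₁.tangent tangentFst
      (⟨θ, ξ⟩ : TangentBundle (I₁.prod I₂).tangent (TangentBundle (I₁.prod I₂) (M₁ × M₂))) =
      tangentMap (I₁.prod I₂).tangent I₁.tangent tangentFst ⟨θ', ξ'⟩ := by
    rw [tangentMap_tangentFst, tangentMap_tangentFst, h]
    exact congrArg (fun ζ : E₁ × E₁ =>
      (⟨tangentFst θ', ζ⟩ : TangentBundle I₁.tangent (TangentBundle I₁ M₁))) hξ
  have h2 := tangentMap_semiconj (hφ.contMDiff_time t) contMDiff_tangentFst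
    (contMDiff_inclFst θ.1.2) (fun _ => rfl) (fun η η' hη => tangentFst_map hφ hη t) h1
  have h3 := ((tangentMap_tangentFst (φ t θ) (flowCoord φ t θ ξ)).symm.trans h2).trans
    (tangentMap_tangentFst (φ t θ') (flowCoord φ t θ' ξ'))
  exact congrArg (fun ζ : TangentBundle I₁.tangent (TangentBundle I₁ M₁) => vec ζ) h3

lemma sndCoord_flowCoord (hφ : IsGeodesicFlow (g₁.prod g₂) φ)
    {θ θ' : TangentBundle (I₁.prod I₂) (M₁ × M₂)} (h : tangentSnd θ = tangentSnd θ') (t : ℝ)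
    {ξ ξ' : (E₁ × E₂) × (E₁ × E₂)} (hξ : sndCoord ξ = sndCoord ξ') :
    sndCoord (flowCoord φ t θ ξ) = sndCoord (flowCoord φ t θ' ξ') := by
  have h1 : tangentMap (I₁.prod I₂).tangent I₂.tangent tangentSnd
      (⟨θ, ξ⟩ : TangentBundle (I₁.prod I₂).tangent (TangentBundle (I₁.prod I₂) (M₁ × M₂))) =
      tangentMap (I₁.prod I₂).tangent I₂.tangent tangentSnd ⟨θ', ξ'⟩ := by
    rw [tangentMap_tangentSnd, tangentMap_tangentSnd, h]
    exact congrArg (fun ζ : E₂ × E₂ =>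
      (⟨tangentSnd θ', ζ⟩ : TangentBundle I₂.tangent (TangentBundle I₂ M₂))) hξ
  have h2 := tangentMap_semiconj (hφ.contMDiff_time t) contMDiff_tangentSnd
    (contMDiff_inclSnd θ.1.1) (fun _ => rfl) (fun η η' hη => tangentSnd_map hφ hη t) h1
  have h3 := ((tangentMap_tangentSnd (φ t θ) (flowCoord φ t θ ξ)).symm.trans h2).trans
    (tangentMap_tangentSnd (φ t θ') (flowCoord φ t θ' ξ'))
  exact congrArg (fun ζ : TangentBundle I₂.tangent (TangentBundle I₂ M₂) => vec ζ) h3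

lemma sasakiForm_prod (g₁ : Metric I₁ M₁) (g₂ : Metric I₂ M₂)
    (θ : TangentBundle (I₁.prod I₂) (M₁ × M₂)) (ξ : (E₁ × E₂) × (E₁ × E₂)) :
    sasakiForm (g₁.prod g₂) θ ξ ξ =
      sasakiForm g₁ (tangentFst θ) (fstCoord ξ) (fstCoord ξ) +
        sasakiForm g₂ (tangentSnd θ) (sndCoord ξ) (sndCoord ξ) := by
  rw [sasakiForm_apply, sasakiForm_apply, sasakiForm_apply, christoffel_prod, metricForm_prod,
    metricForm_prod]
  exact add_add_add_comm _ _ _ _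

/-- The projection to the vectors tangent to the first factor. -/
def projFst : (E₁ × E₂) × (E₁ × E₂) →L[ℝ] (E₁ × E₂) × (E₁ × E₂) :=
  ((ContinuousLinearMap.inl ℝ E₁ E₂).prodMap (ContinuousLinearMap.inl ℝ E₁ E₂)).comp fstCoord

/-- The projection to the vectors tangent to the second factor. -/
def projSnd : (E₁ × E₂) × (E₁ × E₂) →L[ℝ] (E₁ × E₂) × (E₁ × E₂) :=
  ((ContinuousLinearMap.inr ℝ E₁ E₂).prodMap (ContinuousLinearMap.inr ℝ E₁ E₂)).comp sndCoord

lemma fstCoord_projFst (ξ : (E₁ × E₂) × (E₁ × E₂)) : fstCoord (projFst ξ) = fstCoord ξ := rfl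
lemma sndCoord_projFst (ξ : (E₁ × E₂) × (E₁ × E₂)) : sndCoord (projFst ξ) = 0 := rfl
lemma fstCoord_projSnd (ξ : (E₁ × E₂) × (E₁ × E₂)) : fstCoord (projSnd ξ) = 0 := rfl
lemma sndCoord_projSnd (ξ : (E₁ × E₂) × (E₁ × E₂)) : sndCoord (projSnd ξ) = sndCoord ξ := rfl

lemma ext_coord {ξ η : (E₁ × E₂) × (E₁ × E₂)} (h₁ : fstCoord ξ = fstCoord η)
    (h₂ : sndCoord ξ = sndCoord η) : ξ = η :=
  Prod.ext (Prod.ext (Prod.ext_iff.1 h₁).1 (Prod.ext_iff.1 h₂).1)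
    (Prod.ext (Prod.ext_iff.1 h₁).2 (Prod.ext_iff.1 h₂).2)

lemma projFst_add_projSnd (ξ : (E₁ × E₂) × (E₁ × E₂)) : projFst ξ + projSnd ξ = ξ :=
  ext_coord (by rw [map_add, fstCoord_projFst, fstCoord_projSnd, add_zero])
    (by rw [map_add, sndCoord_projFst, sndCoord_projSnd, zero_add])

lemma flowCoord_projFst (hφ : IsGeodesicFlow (g₁.prod g₂) φ) (t : ℝ)
    (θ : TangentBundle (I₁.prod I₂) (M₁ × M₂)) (ξ : (E₁ × E₂) × (E₁ × E₂)) :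
    flowCoord φ t θ (projFst ξ) = projFst (flowCoord φ t θ ξ) := by
  refine ext_coord (fstCoord_flowCoord hφ rfl t rfl) ?_
  have h := sndCoord_flowCoord hφ (θ := θ) rfl t (ξ := projFst ξ) (ξ' := 0)
    (by rw [sndCoord_projFst, map_zero])
  rw [h, map_zero, map_zero, sndCoord_projFst]

lemma flowCoord_projSnd (hφ : IsGeodesicFlow (g₁.prod g₂) φ) (t : ℝ)
    (θ : TangentBundle (I₁.prod I₂) (M₁ × M₂)) (ξ : (E₁ × E₂) × (E₁ × E₂)) :
    flowCoord φ t θ (projSnd ξ) = projSnd (flowCoord φ t θ ξ) := by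
  refine ext_coord ?_ (sndCoord_flowCoord hφ rfl t rfl)
  have h := fstCoord_flowCoord hφ (θ := θ) rfl t (ξ := projSnd ξ) (ξ' := 0)
    (by rw [fstCoord_projSnd, map_zero])
  rw [h, map_zero, map_zero, fstCoord_projSnd]

lemma sasakiForm_projFst_le (θ : TangentBundle (I₁.prod I₂) (M₁ × M₂))
    (ξ : (E₁ × E₂) × (E₁ × E₂)) :
    sasakiForm (g₁.prod g₂) θ (projFst ξ) (projFst ξ) ≤ sasakiForm (g₁.prod g₂) θ ξ ξ := by
  rw [sasakiForm_prod, sasakiForm_prod, fstCoord_projFst, sndCoord_projFst]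
  simpa using sasakiForm_self_nonneg g₂ (tangentSnd θ) (sndCoord ξ)

lemma sasakiForm_projSnd_le (θ : TangentBundle (I₁.prod I₂) (M₁ × M₂))
    (ξ : (E₁ × E₂) × (E₁ × E₂)) :
    sasakiForm (g₁.prod g₂) θ (projSnd ξ) (projSnd ξ) ≤ sasakiForm (g₁.prod g₂) θ ξ ξ := by
  rw [sasakiForm_prod, sasakiForm_prod, fstCoord_projSnd, sndCoord_projSnd]
  simpa using sasakiForm_self_nonneg g₁ (tangentFst θ) (fstCoord ξ)

lemma growth_projFst_congr (hφ : IsGeodesicFlow (g₁.prod g₂) φ)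
    {θ θ' : TangentBundle (I₁.prod I₂) (M₁ × M₂)} (h : tangentFst θ = tangentFst θ') (t : ℝ)
    (ξ : (E₁ × E₂) × (E₁ × E₂)) :
    growth (g₁.prod g₂) φ θ t (projFst ξ) = growth (g₁.prod g₂) φ θ' t (projFst ξ) := by
  unfold growth
  rw [sasakiForm_prod, sasakiForm_prod, fstCoord_flowCoord hφ h t rfl, tangentFst_map hφ h t,
    flowCoord_projFst hφ t θ, flowCoord_projFst hφ t θ', sndCoord_projFst, sndCoord_projFst]
  simp

lemma growth_projSnd_congr (hφ : IsGeodesicFlow (g₁.prod g₂) φ)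
    {θ θ' : TangentBundle (I₁.prod I₂) (M₁ × M₂)} (h : tangentSnd θ = tangentSnd θ') (t : ℝ)
    (ξ : (E₁ × E₂) × (E₁ × E₂)) :
    growth (g₁.prod g₂) φ θ t (projSnd ξ) = growth (g₁.prod g₂) φ θ' t (projSnd ξ) := by
  unfold growth
  rw [sasakiForm_prod, sasakiForm_prod, sndCoord_flowCoord hφ h t rfl, tangentSnd_map hφ h t,
    flowCoord_projSnd hφ t θ, flowCoord_projSnd hφ t θ', fstCoord_projSnd, fstCoord_projSnd]
  simp

end ProductFlow

section StableProjection

variable {E : Type*} [NormedAddCommGroup E] [NormedSpace ℝ E] [FiniteDimensional ℝ E]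
  {H : Type*} [TopologicalSpace H] {I : ModelWithCorners ℝ E H} [I.Boundaryless]
  {M : Type*} [TopologicalSpace M] [ChartedSpace H M] [IsManifold I ∞ M]
  {g : Metric I M}

/-- The quotient map modulo the geodesic vector field, in coordinates. -/
def quotLinear (g : Metric I M) (θ : TangentBundle I M) : E × E →ₗ[ℝ] FlowQuot g θ :=
  toQuot g θ

/-- The contact form at `θ` as a linear map. -/
def contactLinear (g : Metric I M) (θ : TangentBundle I M) : E × E →ₗ[ℝ] ℝ where
  toFun := contactForm g θ
  map_add' := contactForm_add g θ
  map_smul' := contactForm_smul g θ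

/-- The lift of a subspace of the quotient to the kernel of the contact form. -/
def contactLift (F : Distribution g) (θ : TangentBundle I M) : Submodule ℝ (E × E) :=
  LinearMap.ker (contactLinear g θ) ⊓ (F θ).comap (quotLinear g θ)

lemma mem_contactLift {F : Distribution g} {θ : TangentBundle I M} {ξ : E × E} :
    ξ ∈ contactLift F θ ↔ contactForm g θ ξ = 0 ∧ quotCoord g θ ξ ∈ F θ := Iff.rfl

/-- The representative of the class of `ξ` in the kernel of the contact form. -/
def contactRep (g : Metric I M) (θ : TangentBundle I M) (ξ : E × E) : E × E :=
  ξ - contactForm g θ ξ • geodesicCoord g θ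

lemma contactForm_contactRep {θ : TangentBundle I M} (hθ : θ ∈ unitBundle g) (ξ : E × E) :
    contactForm g θ (contactRep g θ ξ) = 0 := by
  rw [contactRep, sub_eq_add_neg, ← neg_smul, contactForm_add, contactForm_smul,
    contactForm_geodesicCoord g hθ]
  ring

lemma quotCoord_contactRep (θ : TangentBundle I M) (ξ : E × E) :
    quotCoord g θ (contactRep g θ ξ) = quotCoord g θ ξ :=
  (quotCoord_eq_iff g θ _ ξ).2 ⟨-contactForm g θ ξ, by simp [contactRep]⟩

lemma span_contactRep {F : Distribution g} {θ : TangentBundle I M} (hθ : θ ∈ unitBundle g)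
    {ι : Type*} {s : ι → E × E}
    (hs : Submodule.span ℝ (range fun i => quotCoord g θ (s i)) = F θ) :
    Submodule.span ℝ (range fun i => contactRep g θ (s i)) = contactLift F θ := by
  refine le_antisymm (Submodule.span_le.2 ?_) fun ξ hξ => ?_
  · rintro _ ⟨i, rfl⟩
    refine ⟨contactForm_contactRep hθ _, ?_⟩
    change quotCoord g θ (contactRep g θ (s i)) ∈ F θ
    rw [quotCoord_contactRep, ← hs]
    exact Submodule.subset_span (mem_range_self i)
  · obtain ⟨h0, h1⟩ := mem_contactLift.1 hξ
    have hr : (range fun i => quotCoord g θ (s i)) =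
        quotLinear g θ '' (range fun i => contactRep g θ (s i)) := by
      rw [← range_comp]
      exact congrArg range (funext fun i => (quotCoord_contactRep θ (s i)).symm)
    rw [← hs, hr, Submodule.span_image] at h1
    obtain ⟨η, hη, h2⟩ := h1
    have h3 : contactForm g θ η = 0 := by
      have : Submodule.span ℝ (range fun i => contactRep g θ (s i)) ≤
          LinearMap.ker (contactLinear g θ) := by
        rw [Submodule.span_le]
        rintro _ ⟨i, rfl⟩
        exact contactForm_contactRep hθ _
      exact this hη
    rwa [quotCoord_injOn g hθ h0 h3 h2.symm]

lemma linearIndependent_contactRep {θ : TangentBundle I M} {ι : Type*} {s : ι → E × E}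
    (hs : LinearIndependent ℝ fun i => quotCoord g θ (s i)) :
    LinearIndependent ℝ fun i => contactRep g θ (s i) := by
  refine LinearIndependent.of_comp (quotLinear g θ) ?_
  convert hs using 2 with i
  exact quotCoord_contactRep θ (s i)

variable {φ : ℝ → TangentBundle I M → TangentBundle I M}

lemma IsHyperbolicSplitting.mem_contactLift_of_commute [T2Space M] {Es Ec Eu : Distribution g}
    {C lam mu : ℝ} (h : IsHyperbolicSplitting g φ Es Ec Eu C lam mu) (hφ : IsGeodesicFlow g φ)
    {P : E × E →L[ℝ] E × E} (hP : ∀ t θ ξ, flowCoord φ t θ (P ξ) = P (flowCoord φ t θ ξ))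
    (hP' : ∀ θ ξ, sasakiForm g θ (P ξ) (P ξ) ≤ sasakiForm g θ ξ ξ)
    {θ : TangentBundle I M} (hθ : θ ∈ unitBundle g) {ξ : E × E} (hξ : ξ ∈ contactLift Es θ) :
    P ξ ∈ contactLift Es θ ∧
      ∃ K, ∀ t : ℝ, 0 ≤ t → growth g φ θ t (P ξ) ≤ K * Real.exp (t * lam) ^ 2 := by
  obtain ⟨h0, h1⟩ := mem_contactLift.1 hξ
  have hlam : lam < 0 := h.lam_lt.trans h.mu_neg
  have hK : ∀ t : ℝ, 0 ≤ t →
      growth g φ θ t (P ξ) ≤ (C ^ 2 * sasakiForm g θ ξ ξ) * Real.exp (t * lam) ^ 2 := by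
    intro t ht
    calc growth g φ θ t (P ξ) ≤ growth g φ θ t ξ := by
          unfold growth
          rw [hP]
          exact hP' _ _
      _ ≤ _ := h.growth_stable_le hφ hθ h0 h1 ht
      _ = _ := by ring
  have hβ : normSqDeriv g θ (P ξ) = 0 := by
    refine pow_eq_zero_iff two_ne_zero |>.1 (le_antisymm ?_ (sq_nonneg _))
    refine nonpos_of_le_exp (K := 4 * (C ^ 2 * sasakiForm g θ ξ ξ)) hlam fun t ht => ?_
    have h2 := normSqDeriv_sq_le g (map_mem_unitBundle hφ hθ t) (flowCoord φ t θ (P ξ))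
    rw [show normSqDeriv g (φ t θ) (flowCoord φ t θ (P ξ)) = normSqDeriv g θ (P ξ) from
      hφ.mfderiv_normSq_flowDeriv t θ (P ξ)] at h2
    have h3 := hK t ht
    unfold growth at h3
    linarith
  have hα : contactForm g θ (P ξ) = 0 := by
    refine pow_eq_zero_iff two_ne_zero |>.1 (le_antisymm ?_ (sq_nonneg _))
    refine nonpos_of_le_exp hlam fun t ht => le_trans ?_ (hK t ht)
    have h2 := contactForm_sq_le g (map_mem_unitBundle hφ hθ t) (flowCoord φ t θ (P ξ))
    rwa [show contactForm g (φ t θ) (flowCoord φ t θ (P ξ)) = contactForm g θ (P ξ) from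
      hφ.contactForm_flowDeriv hβ t] at h2
  exact ⟨⟨hα, h.mem_stable hφ hθ hα hβ hK⟩, _, hK⟩

end StableProjection

section Clopen

/-- If an idempotent preserves a continuous family of subspaces, then the set of parameters where
it restricts to the identity is open and closed. -/
lemma isClopen_setOf_fixed {T : Type*} [TopologicalSpace T] {V : Type*} [NormedAddCommGroup V]
    [NormedSpace ℝ V] [FiniteDimensional ℝ V] (F : T → Submodule ℝ V) (P : V →L[ℝ] V)
    (hPP : ∀ v, P (P v) = P v) (hP : ∀ a, ∀ v ∈ F a, P v ∈ F a)
    (hF : ∀ a₀, ∃ (k : ℕ) (s : Fin k → T → V), (∀ i, ContinuousAt (s i) a₀) ∧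
      ∀ᶠ a in 𝓝 a₀, LinearIndependent ℝ (fun i => s i a) ∧
        Submodule.span ℝ (range fun i => s i a) = F a) :
    IsClopen {a | ∀ v ∈ F a, P v = v} := by
  constructor
  · rw [← isOpen_compl_iff, isOpen_iff_mem_nhds]
    intro a₀ ha₀
    obtain ⟨k, s, hs, hsF⟩ := hF a₀
    obtain ⟨-, h0⟩ := hsF.self_of_nhds
    obtain ⟨i, hi⟩ : ∃ i, P (s i a₀) ≠ s i a₀ := by
      by_contra! hc
      refine ha₀ fun v hv => ?_
      rw [← h0] at hv
      have hle : Submodule.span ℝ (range fun i => s i a₀) ≤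
          LinearMap.eqLocus P.toLinearMap LinearMap.id := by
        rw [Submodule.span_le]
        rintro _ ⟨i, rfl⟩
        exact hc i
      exact hle hv
    have hne : ∀ᶠ a in 𝓝 a₀, P (s i a) ≠ s i a :=
      ((P.continuous.continuousAt.comp (hs i)).ne_iff_eventually_ne (hs i)).1 hi
    filter_upwards [hne, hsF] with a ha hsa hfix
    exact ha (hfix _ (hsa.2 ▸ Submodule.subset_span (mem_range_self i)))
  · rw [isOpen_iff_mem_nhds]
    intro a₀ ha₀
    obtain ⟨k, s, hs, hsF⟩ := hF a₀
    obtain ⟨hi, h0⟩ := hsF.self_of_nhds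
    have hPs : (fun i => P (s i a₀)) = fun i => s i a₀ :=
      funext fun i => ha₀ _ (h0 ▸ Submodule.subset_span (mem_range_self i))
    have hc : ContinuousAt (fun a i => P (s i a)) a₀ :=
      continuousAt_pi.2 fun i => P.continuous.continuousAt.comp (hs i)
    have hev : ∀ᶠ a in 𝓝 a₀, LinearIndependent ℝ (fun i => P (s i a)) :=
      hc.preimage_mem_nhds (isOpen_setOfPred_linearIndependent.mem_nhds
        (show LinearIndependent ℝ (fun i => P (s i a₀)) from hPs ▸ hi))
    filter_upwards [hev, hsF] with a ha hsa v hv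
    have hle : Submodule.span ℝ (range fun i => P (s i a)) ≤ F a := by
      rw [Submodule.span_le]
      rintro _ ⟨i, rfl⟩
      exact hP a _ (hsa.2 ▸ Submodule.subset_span (mem_range_self i))
    have heq := Submodule.eq_of_le_of_finrank_eq hle
      (by rw [finrank_span_eq_card ha, ← hsa.2, finrank_span_eq_card hsa.1])
    rw [← heq] at hv
    have hle' : Submodule.span ℝ (range fun i => P (s i a)) ≤
        LinearMap.eqLocus P.toLinearMap LinearMap.id := by
      rw [Submodule.span_le]
      rintro _ ⟨i, rfl⟩
      exact hPP _
    exact hle' hv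

end Clopen

section UnitPath

variable {E₁ : Type*} [NormedAddCommGroup E₁] [NormedSpace ℝ E₁] [FiniteDimensional ℝ E₁]
  {H₁ : Type*} [TopologicalSpace H₁] {I₁ : ModelWithCorners ℝ E₁ H₁} [I₁.Boundaryless]
  {M₁ : Type*} [TopologicalSpace M₁] [ChartedSpace H₁ M₁] [IsManifold I₁ ∞ M₁]
  {E₂ : Type*} [NormedAddCommGroup E₂] [NormedSpace ℝ E₂] [FiniteDimensional ℝ E₂]
  {H₂ : Type*} [TopologicalSpace H₂] {I₂ : ModelWithCorners ℝ E₂ H₂} [I₂.Boundaryless]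
  {M₂ : Type*} [TopologicalSpace M₂] [ChartedSpace H₂ M₂] [IsManifold I₂ ∞ M₂]
  {g₁ : Metric I₁ M₁} {g₂ : Metric I₂ M₂}

lemma exists_unit {E : Type*} [NormedAddCommGroup E] [NormedSpace ℝ E] [FiniteDimensional ℝ E]
    {H : Type*} [TopologicalSpace H] {I : ModelWithCorners ℝ E H} [I.Boundaryless]
    {M : Type*} [TopologicalSpace M] [ChartedSpace H M] [IsManifold I ∞ M]
    (hdim : 0 < Module.finrank ℝ E) (g : Metric I M) (x : M) : ∃ v : E, metricForm g x v v = 1 := by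
  have := Module.finrank_pos_iff.1 hdim
  obtain ⟨v, hv⟩ := exists_ne (0 : E)
  have hpos : 0 < metricForm g x v v := g.pos x v hv
  refine ⟨(√(metricForm g x v v))⁻¹ • v, ?_⟩
  rw [map_smul, map_smul, LinearMap.smul_apply, smul_eq_mul, smul_eq_mul, ← mul_assoc, ← mul_inv,
    Real.mul_self_sqrt hpos.le, inv_mul_cancel₀ hpos.ne']

variable (I₁ I₂) in
/-- The path of vectors `(cos a • v, sin a • w)` at the point `p` of the product. -/
def unitPath (p : M₁ × M₂) (v : E₁) (w : E₂) (a : ℝ) : TangentBundle (I₁.prod I₂) (M₁ × M₂) :=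
  ⟨p, ((Real.cos a • v, Real.sin a • w) : E₁ × E₂)⟩

lemma unitPath_mem (p : M₁ × M₂) {v : E₁} {w : E₂} (hv : metricForm g₁ p.1 v v = 1)
    (hw : metricForm g₂ p.2 w w = 1) (a : ℝ) :
    unitPath I₁ I₂ p v w a ∈ unitBundle (g₁.prod g₂) := by
  change metricForm (g₁.prod g₂) p (Real.cos a • v, Real.sin a • w)
    (Real.cos a • v, Real.sin a • w) = 1
  rw [metricForm_prod]
  simp only [map_smul, LinearMap.smul_apply, hv, hw, smul_eq_mul, mul_one]
  rw [← sq, ← sq, Real.cos_sq_add_sin_sq]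

lemma continuous_unitPath (p : M₁ × M₂) (v : E₁) (w : E₂) :
    Continuous (unitPath I₁ I₂ p v w) := by
  rw [continuous_iff_continuousAt]
  intro a₀
  rw [FiberBundle.continuousAt_totalSpace]
  refine ⟨continuousAt_const, ?_⟩
  have h1 : Continuous fun a : ℝ => (Real.cos a • v, Real.sin a • w) := by fun_prop
  refine h1.continuousAt.congr ?_
  filter_upwards with a
  rw [TangentBundle.trivializationAt_apply]
  exact (tangentCoordChange_self (I := I₁.prod I₂) (mem_extChartAt_source p)).symm

lemma continuousAt_coord_of_section (p : M₁ × M₂) (v : E₁) (w : E₂)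
    {s : ∀ θ : TangentBundle (I₁.prod I₂) (M₁ × M₂), TangentSpace (I₁.prod I₂).tangent θ} {a₀ : ℝ}
    (hs : ContinuousAt (fun a => (⟨unitPath I₁ I₂ p v w a, s (unitPath I₁ I₂ p v w a)⟩ :
      TangentBundle (I₁.prod I₂).tangent (TangentBundle (I₁.prod I₂) (M₁ × M₂)))) a₀) :
    ContinuousAt (fun a => (s (unitPath I₁ I₂ p v w a) : (E₁ × E₂) × (E₁ × E₂))) a₀ := by
  rw [FiberBundle.continuousAt_totalSpace] at hs
  refine hs.2.congr ?_
  filter_upwards with a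
  rw [TangentBundle.trivializationAt_apply]
  exact tangentCoordChange_self (I := (I₁.prod I₂).tangent)
    (mem_extChartAt_source (unitPath I₁ I₂ p v w a))

lemma continuousAt_contactRep (p : M₁ × M₂) (v : E₁) (w : E₂)
    {σ : ℝ → (E₁ × E₂) × (E₁ × E₂)} {a₀ : ℝ} (hσ : ContinuousAt σ a₀) :
    ContinuousAt (fun a => contactRep (g₁.prod g₂) (unitPath I₁ I₂ p v w a) (σ a)) a₀ := by
  have h1 : ContinuousAt (fun a => contactForm (g₁.prod g₂) (unitPath I₁ I₂ p v w a) (σ a)) a₀ := by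
    let b : (E₁ × E₂) →L[ℝ] (E₁ × E₂) →L[ℝ] ℝ := (g₁.prod g₂).inner p
    change ContinuousAt (fun a => b (σ a).1 (Real.cos a • v, Real.sin a • w)) a₀
    have h2 : ContinuousAt (fun a : ℝ => (Real.cos a • v, Real.sin a • w)) a₀ := by fun_prop
    exact (b.continuous.continuousAt.comp (continuous_fst.continuousAt.comp hσ)).clm_apply h2
  have h2 : ContinuousAt (fun a => geodesicCoord (g₁.prod g₂) (unitPath I₁ I₂ p v w a)) a₀ := by
    have h3 (a : ℝ) : geodesicCoord (g₁.prod g₂) (unitPath I₁ I₂ p v w a) =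
        ((Real.cos a • v, Real.sin a • w),
          -((Real.cos a * Real.cos a) • christoffel g₁ p.1 v v,
            (Real.sin a * Real.sin a) • christoffel g₂ p.2 w w)) := by
      rw [← christoffel_smul_smul, ← christoffel_smul_smul]
      exact Prod.ext rfl (congrArg Neg.neg (christoffel_prod g₁ g₂ p _ _))
    simp only [h3]
    fun_prop
  exact hσ.sub (h1.smul h2)

lemma exists_frame {F : Distribution (g₁.prod g₂)}
    (hF : IsContinuousSubbundle (g₁.prod g₂) F) (p : M₁ × M₂) {v : E₁} {w : E₂}
    (hv : metricForm g₁ p.1 v v = 1) (hw : metricForm g₂ p.2 w w = 1) (a₀ : ℝ) :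
    ∃ (k : ℕ) (s : Fin k → ℝ → (E₁ × E₂) × (E₁ × E₂)), (∀ i, ContinuousAt (s i) a₀) ∧
      ∀ᶠ a in 𝓝 a₀, LinearIndependent ℝ (fun i => s i a) ∧
        Submodule.span ℝ (range fun i => s i a) = contactLift F (unitPath I₁ I₂ p v w a) := by
  have hmem := unitPath_mem (I₁ := I₁) (I₂ := I₂) p hv hw
  obtain ⟨U, hU, k, s, hs, hsF⟩ := hF _ (hmem a₀)
  have hev : ∀ᶠ a in 𝓝 a₀, unitPath I₁ I₂ p v w a ∈ U :=
    (continuous_unitPath p v w).continuousAt.preimage_mem_nhds hU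
  refine ⟨k, fun i a => contactRep (g₁.prod g₂) (unitPath I₁ I₂ p v w a)
    (s i (unitPath I₁ I₂ p v w a)), fun i => continuousAt_contactRep p v w
    (continuousAt_coord_of_section p v w ?_), ?_⟩
  · have h1 := hs i _ ⟨mem_of_mem_nhds hU, hmem a₀⟩
    refine Filter.Tendsto.comp h1 (tendsto_nhdsWithin_iff.2
      ⟨(continuous_unitPath p v w).continuousAt, ?_⟩)
    filter_upwards [hev] with a ha using ⟨ha, hmem a⟩
  · filter_upwards [hev] with a ha
    obtain ⟨h1, h2⟩ := hsF _ ⟨ha, hmem a⟩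
    exact ⟨linearIndependent_contactRep h1, span_contactRep (hmem a) h2⟩

end UnitPath

/-- The geodesic flow of a product of manifolds of positive dimension is never partially
hyperbolic; in fact it has no hyperbolic splitting at all. -/
theorem not_isHyperbolicSplitting_prod
    {E₁ : Type*} [NormedAddCommGroup E₁] [NormedSpace ℝ E₁] [FiniteDimensional ℝ E₁]
    {H₁ : Type*} [TopologicalSpace H₁] {I₁ : ModelWithCorners ℝ E₁ H₁} [I₁.Boundaryless]
    {M₁ : Type*} [TopologicalSpace M₁] [ChartedSpace H₁ M₁] [IsManifold I₁ ∞ M₁] [T2Space M₁]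
    {E₂ : Type*} [NormedAddCommGroup E₂] [NormedSpace ℝ E₂] [FiniteDimensional ℝ E₂]
    {H₂ : Type*} [TopologicalSpace H₂] {I₂ : ModelWithCorners ℝ E₂ H₂} [I₂.Boundaryless]
    {M₂ : Type*} [TopologicalSpace M₂] [ChartedSpace H₂ M₂] [IsManifold I₂ ∞ M₂] [T2Space M₂]
    {g₁ : Metric I₁ M₁} {g₂ : Metric I₂ M₂} (p : M₁ × M₂)
    (hdim₁ : 0 < Module.finrank ℝ E₁) (hdim₂ : 0 < Module.finrank ℝ E₂)
    {φ : ℝ → TangentBundle (I₁.prod I₂) (M₁ × M₂) → TangentBundle (I₁.prod I₂) (M₁ × M₂)}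
    (hφ : IsGeodesicFlow (g₁.prod g₂) φ) {Es Ec Eu : Distribution (g₁.prod g₂)} {C lam mu : ℝ} :
    ¬ IsHyperbolicSplitting (g₁.prod g₂) φ Es Ec Eu C lam mu := by
  intro h
  have hlam : lam < 0 := h.lam_lt.trans h.mu_neg
  obtain ⟨v, hv⟩ := exists_unit hdim₁ g₁ p.1
  obtain ⟨w, hw⟩ := exists_unit hdim₂ g₂ p.2
  let γ := unitPath I₁ I₂ p v w
  have hγ : ∀ a, γ a ∈ unitBundle (g₁.prod g₂) := unitPath_mem p hv hw
  have h₁ (a : ℝ) {ξ : (E₁ × E₂) × (E₁ × E₂)} (hξ : ξ ∈ contactLift Es (γ a)) :=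
    h.mem_contactLift_of_commute hφ (flowCoord_projFst hφ) sasakiForm_projFst_le (hγ a) hξ
  have h₂ (a : ℝ) {ξ : (E₁ × E₂) × (E₁ × E₂)} (hξ : ξ ∈ contactLift Es (γ a)) :=
    h.mem_contactLift_of_commute hφ (flowCoord_projSnd hφ) sasakiForm_projSnd_le (hγ a) hξ
  have hclopen := isClopen_setOf_fixed (fun a => contactLift Es (γ a)) projFst (fun _ => rfl)
    (fun a ξ hξ => (h₁ a hξ).1) (exists_frame h.cont_s p hv hw)
  have hzero : (0 : ℝ) ∈ {a | ∀ ξ ∈ contactLift Es (γ a), projFst ξ = ξ} := by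
    intro ξ hξ
    obtain ⟨-, K, hK⟩ := h₂ 0 hξ
    have hsnd : tangentSnd (γ 0) = tangentSnd (scale 0 (γ 0)) :=
      congrArg (fun u : E₂ => (⟨p.2, u⟩ : TangentBundle I₂ M₂))
        (show Real.sin 0 • w = (0 : ℝ) • Real.sin 0 • w by simp)
    have h0 : projSnd ξ = 0 := hφ.eq_zero_of_growth_le (γ 0) hlam fun t ht => by
      rw [← growth_projSnd_congr hφ hsnd]
      exact hK t ht
    have := projFst_add_projSnd ξ
    rwa [h0, add_zero] at this
  have huniv := hclopen.eq_univ ⟨0, hzero⟩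
  have hmem : Real.pi / 2 ∈ {a | ∀ ξ ∈ contactLift Es (γ a), projFst ξ = ξ} :=
    huniv ▸ mem_univ _
  refine h.nontrivial_s _ (hγ (Real.pi / 2)) ((Submodule.eq_bot_iff _).2 fun q hq => ?_)
  obtain ⟨ξ, rfl, hξ, -⟩ := exists_lift _ (hγ (Real.pi / 2)) ((h.le_unitQuot (hγ _)).1 hq)
  obtain ⟨-, K, hK⟩ := h₁ (Real.pi / 2) (ξ := ξ) ⟨hξ, hq⟩
  have hfst : tangentFst (γ (Real.pi / 2)) = tangentFst (scale 0 (γ (Real.pi / 2))) :=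
    congrArg (fun u : E₁ => (⟨p.1, u⟩ : TangentBundle I₁ M₁))
      (show Real.cos (Real.pi / 2) • v = (0 : ℝ) • Real.cos (Real.pi / 2) • v by simp)
  have h0 : projFst ξ = 0 := hφ.eq_zero_of_growth_le (γ (Real.pi / 2)) hlam fun t ht => by
    rw [← growth_projFst_congr hφ hfst]
    exact hK t ht
  have h3 := hmem ξ ⟨hξ, hq⟩
  rw [h0] at h3
  rw [← h3]
  exact map_zero (quotLinear _ _)

end GeodesicFlow

end

theorem theoremD
    {E₁ : Type*} [NormedAddCommGroup E₁] [NormedSpace ℝ E₁] [FiniteDimensional ℝ E₁]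
    {H₁ : Type*} [TopologicalSpace H₁] {I₁ : ModelWithCorners ℝ E₁ H₁} [I₁.Boundaryless]
    {M₁ : Type*} [TopologicalSpace M₁] [ChartedSpace H₁ M₁] [IsManifold I₁ ∞ M₁] [T2Space M₁]
    [Nonempty M₁]
    {E₂ : Type*} [NormedAddCommGroup E₂] [NormedSpace ℝ E₂] [FiniteDimensional ℝ E₂]
    {H₂ : Type*} [TopologicalSpace H₂] {I₂ : ModelWithCorners ℝ E₂ H₂} [I₂.Boundaryless]
    {M₂ : Type*} [TopologicalSpace M₂] [ChartedSpace H₂ M₂] [IsManifold I₂ ∞ M₂] [T2Space M₂]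
    [Nonempty M₂]
    (hdim₁ : 0 < Module.finrank ℝ E₁) (hdim₂ : 0 < Module.finrank ℝ E₂)
    (g₁ : GeodesicFlow.Metric I₁ M₁) (g₂ : GeodesicFlow.Metric I₂ M₂)
    (hAnosov : GeodesicFlow.HasAnosovGeodesicFlow g₁ ∨ GeodesicFlow.HasAnosovGeodesicFlow g₂) :
    ¬ GeodesicFlow.HasPartiallyHyperbolicGeodesicFlow (GeodesicFlow.Metric.prod g₁ g₂) := by
  rintro ⟨φ, hφ, Es, Ec, Eu, C, lam, mu, h, -⟩
  exact GeodesicFlow.not_isHyperbolicSplitting_prod (Classical.arbitrary (M₁ × M₂)) hdim₁ hdim₂ hφ h
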